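/- Let $k$ be a separably closed field and let $X$ be an integral separated scheme of finite type over $k$ such that every invertible global regular function on $X$ is constant, i.e. $\mathcal{O}_X(X)^\times=k^\times$. Let $M$ be a finitely generated abelian group such that the characteristic of $k$ does not divide the order of the torsion subgroup of $M$ (no condition in characteristic $0$), and let $\lambda\colon M\to\operatorname{Pic}(X)$ be a group homomorphism. For a Cartier divisor $D$ on $X$, given by local equations $f_i\in K(X)^\times$ on the members $U_i$ of an open covering of $X$, let $\mathcal{O}_X(D)$ be the invertible subsheaf of the constant sheaf $K(X)$ with $\mathcal{O}_X(D)|_{U_i}=f_i^{-1}\mathcal{O}_{U_i}$, and let $[D]\in\operatorname{Pic}(X)$ be its isomorphism class. A *Cox sheaf of $X$ of type $\lambda$* is a sheaf $\mathcal{R}$ of $M$-graded commutative $\mathcal{O}_X$-algebras, with degree-$m$-parts $\mathcal{R}_m$, together with isomorphisms of $\mathcal{O}_X$-modules $$\psi_{m,D}\colon\mathcal{R}_m\to\mathcal{O}_X(D)$$ for all pairs $(m,D)$ consisting of an element $m\in M$ and a Cartier divisor $D$ on $X$ with $[D]=\lambda(m)$, such that for any two such pairs $(m_1,D_1)$, $(m_2,D_2)$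 there is a nonzero constant $\alpha\in k$ with $$\psi_{m_1,D_1}(s_1)\,\psi_{m_2,D_2}(s_2)=\alpha\,\psi_{m_1+m_2,\,D_1+D_2}(s_1s_2)$$ for all open $U\subseteq X$ and all $s_i\in\mathcal{R}_{m_i}(U)$, $i=1,2$. A morphism of Cox sheaves of type $\lambda$ is a morphism of $M$-graded $\mathcal{O}_X$-algebras. Then there exists exactly one isomorphism class of Cox sheaves of $X$ of type $\lambda$: a Cox sheaf of $X$ of type $\lambda$ exists, and any two Cox sheaves of $X$ of type $\lambda$ are isomorphic. -/

import Mathlib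

universe u

open CategoryTheory AlgebraicGeometry TopologicalSpace Opposite

open scoped TensorProduct

noncomputable section

namespace CoxSheaves

/-! ### Presheaves of modules, sheafified tensor products, and the Picard group -/

variable {X : Scheme.{u}}

/-- Presheaves of `𝒪_X`-modules. -/
abbrev PreMod (X : Scheme.{u}) := PresheafOfModules.{u} (X.presheaf ⋙ forget₂ CommRingCat RingCat)

/-- The sections `P(U)`. -/
def Sections (P : PreMod X) (U : X.Opens) : Type u := P.obj (op U)

instance (P : PreMod X) (U : X.Opens) : AddCommGroup (Sections P U) :=
  inferInstanceAs (AddCommGroup (P.obj (op U)))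

instance (P : PreMod X) (U : X.Opens) : Module Γ(X, U) (Sections P U) :=
  inferInstanceAs (Module Γ(X, U) (P.obj (op U)))

/-- The restriction map `𝒪_X(U) → 𝒪_X(V)`. -/
def resO {U V : X.Opens} (h : V ≤ U) : Γ(X, U) →+* Γ(X, V) := (X.presheaf.map (homOfLE h).op).hom

/-- The restriction map `P(U) → P(V)`. -/
def res (P : PreMod X) {U V : X.Opens} (h : V ≤ U) : Sections P U →+ Sections P V :=
  (P.presheaf.map (homOfLE h).op).hom

theorem res_smul (P : PreMod X) {U V : X.Opens} (h : V ≤ U) (r : Γ(X, U)) (s : Sections P U) :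
    res P h (r • s) = resO h r • res P h s :=
  P.map_smul (homOfLE h).op r s

@[simp] theorem resO_resO {U V W : X.Opens} (h : V ≤ U) (h' : W ≤ V) (r : Γ(X, U)) :
    resO h' (resO h r) = resO (h'.trans h) r := by
  simp only [resO]
  rw [← RingHom.comp_apply, ← CommRingCat.hom_comp, ← Functor.map_comp]
  rfl

@[simp] theorem res_res (P : PreMod X) {U V W : X.Opens} (h : V ≤ U) (h' : W ≤ V) (s : Sections P U) :
    res P h' (res P h s) = res P (h'.trans h) s :=
  (P.map_comp_apply (homOfLE h).op (homOfLE h').op s).symm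

@[simp] theorem res_self (P : PreMod X) {U : X.Opens} (s : Sections P U) : res P le_rfl s = s := by
  change P.presheaf.map (𝟙 (op U)) s = s
  rw [P.presheaf.map_id]
  rfl

/-- The map on sections over `U` induced by a morphism of presheaves of modules. -/
def homSections {P Q : PreMod X} (φ : P ⟶ Q) (U : X.Opens) : Sections P U →ₗ[Γ(X, U)] Sections Q U :=
  (φ.app (op U)).hom

theorem homSec_res {P Q : PreMod X} (φ : P ⟶ Q) {U V : X.Opens} (h : V ≤ U) (s : Sections P U) :
    homSections φ V (res P h s) = res Q h (homSections φ U s) :=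
  PresheafOfModules.naturality_apply φ (homOfLE h).op s

/-- A morphism of presheaves of modules from its maps on sections. -/
def homOfSections {P Q : PreMod X} (φ : ∀ U, Sections P U →ₗ[Γ(X, U)] Sections Q U)
    (hφ : ∀ {U V : X.Opens} (h : V ≤ U) (s : Sections P U), φ V (res P h s) = res Q h (φ U s)) :
    P ⟶ Q where
  app U := ModuleCat.ofHom (φ U.unop)
  naturality i := by
    ext s
    exact hφ i.unop.le s

theorem homSec_homOfSec {P Q : PreMod X} (φ : ∀ U, Sections P U →ₗ[Γ(X, U)] Sections Q U)
    (hφ : ∀ {U V : X.Opens} (h : V ≤ U) (s : Sections P U), φ V (res P h s) = res Q h (φ U s))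
    (U : X.Opens) : homSections (homOfSections φ hφ) U = φ U := rfl

/-- The presheaf tensor product `U ↦ P(U) ⊗ Q(U)`. -/
def tensorPre (P Q : PreMod X) : PreMod X := MonoidalCategory.tensorObj P Q

/-- The sections of the presheaf tensor product. -/
def tensorPreEquiv (P Q : PreMod X) (U : X.Opens) :
    (Sections P U ⊗[Γ(X, U)] Sections Q U) ≃ₗ[Γ(X, U)] Sections (tensorPre P Q) U := LinearEquiv.refl _ _

theorem res_tensorPreEquiv_tmul (P Q : PreMod X) {U V : X.Opens} (h : V ≤ U) (s : Sections P U) (t : Sections Q U) :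
    res (tensorPre P Q) h (tensorPreEquiv P Q U (s ⊗ₜ t)) = tensorPreEquiv P Q V (res P h s ⊗ₜ res Q h t) := rfl

/-- The morphism `φ ⊗ R`. -/
def whiskerRight {P Q : PreMod X} (φ : P ⟶ Q) (R : PreMod X) : tensorPre P R ⟶ tensorPre Q R :=
  MonoidalCategory.whiskerRight φ R

theorem homSec_whiskerRight {P Q : PreMod X} (φ : P ⟶ Q) (R : PreMod X) (U : X.Opens)
    (s : Sections P U) (t : Sections R U) :
    homSections (whiskerRight φ R) U (tensorPreEquiv P R U (s ⊗ₜ t)) =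
      tensorPreEquiv Q R U (homSections φ U s ⊗ₜ t) := rfl

/-- The underlying presheaf of modules of a sheaf of modules. -/
def toPreMod (L : X.Modules) : PreMod X := L.val

/-- The sheaf of modules associated with a presheaf of modules. -/
def sheafify (P : PreMod X) : X.Modules :=
  (PresheafOfModules.sheafification (R := X.ringCatSheaf) (𝟙 X.ringCatSheaf.obj)).obj P

/-- The canonical morphism to the associated sheaf. -/
def toSheafification (P : PreMod X) : P ⟶ toPreMod (sheafify P) where
  app U := (((PresheafOfModules.sheafificationAdjunction (R := X.ringCatSheaf)
    (𝟙 X.ringCatSheaf.obj)).unit.app P).app U)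
  naturality g := (((PresheafOfModules.sheafificationAdjunction (R := X.ringCatSheaf)
    (𝟙 X.ringCatSheaf.obj)).unit.app P).naturality g)

/-- The tensor product of `𝒪_X`-modules: the sheaf associated with the presheaf
tensor product. -/
def tensor (L L' : X.Modules) : X.Modules := sheafify (tensorPre (toPreMod L) (toPreMod L'))

/-- `P` is locally free of rank one: every point has an open neighbourhood `U` with a section
`e ∈ P(U)` such that multiplication with `e` is an isomorphism `𝒪_U → P|_U`. -/
def IsInvertible (P : PreMod X) : Prop :=
  ∀ x : X, ∃ U : X.Opens, x ∈ U ∧ ∃ e : Sections P U, ∀ (V : X.Opens) (h : V ≤ U),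
    Function.Bijective (fun r : Γ(X, V) ↦ r • res P h e)

theorem covering_iff {U : X.Opens} (S : Sieve U) :
    S ∈ Opens.grothendieckTopology X U ↔ ∀ x ∈ U, ∃ (V : X.Opens) (h : V ≤ U), x ∈ V ∧ S.arrows (homOfLE h) := by
  constructor
  · intro h x hx
    obtain ⟨V, f, hf, hV⟩ := h x hx
    exact ⟨V, f.le, hV, hf⟩
  · intro h x hx
    obtain ⟨V, f, hf, hV⟩ := h x hx
    exact ⟨V, homOfLE f, hV, hf⟩

/-- A morphism that is an isomorphism locally, up to refining the open sets. -/
structure IsLocallyBijective {P Q : PreMod X} (φ : P ⟶ Q) : Prop where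
  inj : ∀ (U : X.Opens) (s : Sections P U), homSections φ U s = 0 → ∀ x ∈ U,
    ∃ (V : X.Opens) (h : V ≤ U), x ∈ V ∧ res P h s = 0
  surj : ∀ (U : X.Opens) (t : Sections Q U), ∀ x ∈ U,
    ∃ (V : X.Opens) (h : V ≤ U), x ∈ V ∧ ∃ s : Sections P V, homSections φ V s = res Q h t

theorem IsLocallyBijective.of_generators {P Q : PreMod X} (φ : P ⟶ Q)
    (h : ∀ x : X, ∃ U : X.Opens, x ∈ U ∧ ∀ V ≤ U, Function.Bijective (homSections φ V)) :
    IsLocallyBijective φ where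
  inj U s hs x hx := by
    obtain ⟨W, hxW, hW⟩ := h x
    refine ⟨U ⊓ W, inf_le_left, ⟨hx, hxW⟩, (hW _ inf_le_right).1 ?_⟩
    rw [homSec_res, hs, map_zero, map_zero]
  surj U t x hx := by
    obtain ⟨W, hxW, hW⟩ := h x
    exact ⟨U ⊓ W, inf_le_left, ⟨hx, hxW⟩, (hW _ inf_le_right).2 _⟩

theorem locBij_toSheafification (P : PreMod X) : IsLocallyBijective (toSheafification P) where
  inj U s hst x hx := by
    have := Presheaf.equalizerSieve_mem (Opens.grothendieckTopology X)
      (CategoryTheory.toSheafify (Opens.grothendieckTopology X)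
        (PresheafOfModules.presheaf (R := X.ringCatSheaf.obj) P)) (X := op U) s 0
        (hst.trans (map_zero (homSections (toSheafification P) U)).symm)
    obtain ⟨V, h, hxV, e⟩ := (covering_iff _).1 this x hx
    exact ⟨V, h, hxV, e.trans (map_zero (res P h))⟩
  surj U t x hx := by
    have := Presheaf.imageSieve_mem (Opens.grothendieckTopology X)
      (CategoryTheory.toSheafify (Opens.grothendieckTopology X)
        (PresheafOfModules.presheaf (R := X.ringCatSheaf.obj) P)) (U := op U) t
    exact (covering_iff _).1 this x hx

theorem isIso_sheafification_map {C : Type*} [Category* C] {J : GrothendieckTopology C}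
    {R : Sheaf J RingCat.{u}} [J.WEqualsLocallyBijective AddCommGrpCat.{u}]
    [HasWeakSheafify J AddCommGrpCat.{u}] {P Q : PresheafOfModules.{u} R.obj} (φ : P ⟶ Q)
    (h₁ : Presheaf.IsLocallyInjective J ((PresheafOfModules.toPresheaf R.obj).map φ))
    (h₂ : Presheaf.IsLocallySurjective J ((PresheafOfModules.toPresheaf R.obj).map φ)) :
    IsIso ((PresheafOfModules.sheafification (𝟙 R.obj)).map φ) := by
  have hW : (J.W.inverseImage (PresheafOfModules.toPresheaf R.obj)) φ := by
    rw [MorphismProperty.inverseImage_iff, GrothendieckTopology.W_iff_isLocallyBijective]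
    exact ⟨h₁, h₂⟩
  rw [PresheafOfModules.inverseImage_W_toPresheaf_eq_inverseImage_isomorphisms (𝟙 R.obj)] at hW
  rwa [MorphismProperty.inverseImage_iff, MorphismProperty.isomorphisms.iff] at hW

theorem IsLocallyBijective.nonempty_iso {P Q : PreMod X} {φ : P ⟶ Q} (h : IsLocallyBijective φ) :
    Nonempty (sheafify P ≅ sheafify Q) := by
  have := isIso_sheafification_map (R := X.ringCatSheaf) φ
    { equalizerSieve_mem := fun {U} s t hst => by
        rw [covering_iff]
        intro x hx
        have hst' : homSections φ U.unop s = homSections φ U.unop t := hst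
        obtain ⟨V, hV, hxV, h0⟩ := h.inj U.unop (HSub.hSub (α := Sections P U.unop) (β := Sections P U.unop) s t)
          ((map_sub _ _ _).trans (sub_eq_zero.2 hst')) x hx
        refine ⟨V, hV, hxV, ?_⟩
        exact sub_eq_zero.1 ((map_sub (res P hV) _ _).symm.trans h0) }
    { imageSieve_mem := fun {U} t => by
        rw [covering_iff]
        intro x hx
        exact h.surj U t x hx }
  exact ⟨@asIso _ _ _ _ ((PresheafOfModules.sheafification (R := X.ringCatSheaf)
    (𝟙 X.ringCatSheaf.obj)).map φ) this⟩

theorem sec_ext (L : X.Modules) {U : X.Opens} (s t : Sections (toPreMod L) U)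
    (h : ∀ x ∈ U, ∃ (V : X.Opens) (h : V ≤ U), x ∈ V ∧
      res (toPreMod L) h s = res (toPreMod L) h t) : s = t := by
  choose V hV hxV e using h
  exact TopCat.Sheaf.eq_of_locally_eq' ⟨L.presheaf, L.isSheaf⟩ (fun x : U ↦ V x.1 x.2) U
    (fun x ↦ homOfLE (hV x.1 x.2)) (fun x hx ↦ Opens.mem_iSup.2 ⟨⟨x, hx⟩, hxV x hx⟩) s t
    (fun x ↦ e x.1 x.2)

theorem resO_ext {U : X.Opens} (s t : Γ(X, U))
    (h : ∀ x ∈ U, ∃ (V : X.Opens) (h : V ≤ U), x ∈ V ∧ resO h s = resO h t) : s = t := by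
  choose V hV hxV e using h
  exact TopCat.Sheaf.eq_of_locally_eq' X.sheaf (fun x : U ↦ V x.1 x.2) U
    (fun x ↦ homOfLE (hV x.1 x.2)) (fun x hx ↦ Opens.mem_iSup.2 ⟨⟨x, hx⟩, hxV x hx⟩) s t
    (fun x ↦ e x.1 x.2)

theorem resO_glue {V : X.Opens} (W : V → X.Opens) (h : ∀ x, W x ≤ V) (hx : ∀ x, x.1 ∈ W x)
    (r : ∀ x, Γ(X, W x)) (hr : ∀ x y, resO inf_le_left (r x) = resO inf_le_right (r y)
      (V := W x ⊓ W y)) : ∃ r₀ : Γ(X, V), ∀ x, resO (h x) r₀ = r x := by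
  obtain ⟨r₀, hr₀, -⟩ := TopCat.Sheaf.existsUnique_gluing' X.sheaf W V (fun x ↦ homOfLE (h x))
    (fun x hxV ↦ Opens.mem_iSup.2 ⟨⟨x, hxV⟩, hx ⟨x, hxV⟩⟩) r hr
  exact ⟨r₀, hr₀⟩

theorem isInvertible_sheafify {P : PreMod X} (hP : IsInvertible P) : IsInvertible (toPreMod (sheafify P)) := by
  intro x
  obtain ⟨U, hxU, e, he⟩ := hP x
  set φ := toSheafification P
  have smul_eq (V : X.Opens) (h : V ≤ U) (r : Γ(X, V)) :
      r • res (toPreMod (sheafify P)) h (homSections φ U e) = homSections φ V (r • res P h e) := by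
    rw [map_smul, homSec_res]
  have inj (V : X.Opens) (h : V ≤ U) : Function.Injective (fun r : Γ(X, V) ↦
      homSections φ V (r • res P h e)) := by
    intro r r' hr
    refine resO_ext _ _ fun x hx ↦ ?_
    obtain ⟨W, hW, hxW, hr⟩ := (locBij_toSheafification P).inj V _ ((map_sub _ _ _).trans
      (sub_eq_zero.2 hr)) x hx
    refine ⟨W, hW, hxW, (he W (hW.trans h)).1 ?_⟩
    rw [map_sub, res_smul, res_smul, res_res] at hr
    exact sub_eq_zero.1 hr
  refine ⟨U, hxU, homSections φ U e, fun V h ↦ ?_⟩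
  simp_rw [smul_eq]
  refine ⟨inj V h, fun c ↦ ?_⟩
  have key (x : V) : ∃ (W : X.Opens) (h' : W ≤ V) (r : Γ(X, W)), x.1 ∈ W ∧
      homSections φ W (r • res P (h'.trans h) e) = res _ h' c := by
    obtain ⟨W, h', hxW, s, hs⟩ := (locBij_toSheafification P).surj V c x.1 x.2
    obtain ⟨r, rfl⟩ := (he W (h'.trans h)).2 s
    exact ⟨W, h', r, hxW, hs⟩
  choose W h' r hxW hr using key
  obtain ⟨r₀, hr₀⟩ := resO_glue W h' hxW r (fun x y ↦ by
    apply inj (W x ⊓ W y) (inf_le_left.trans ((h' x).trans h))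
    have hx := congrArg (res _ (inf_le_left : W x ⊓ W y ≤ W x)) (hr x)
    have hy := congrArg (res _ (inf_le_right : W x ⊓ W y ≤ W y)) (hr y)
    rw [← homSec_res, res_smul, res_res, res_res] at hx hy
    exact hx.trans hy.symm)
  refine ⟨r₀, sec_ext _ _ _ fun x hx ↦ ⟨W ⟨x, hx⟩, h' _, hxW ⟨x, hx⟩, ?_⟩⟩
  rw [← hr, ← hr₀, ← homSec_res, res_smul, res_res]

/-- The isomorphism given by a generator. -/
def genEquiv {P : PreMod X} {V : X.Opens} (e : Sections P V)
    (he : Function.Bijective (fun r : Γ(X, V) ↦ r • e)) : Γ(X, V) ≃ₗ[Γ(X, V)] Sections P V :=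
  LinearEquiv.ofBijective (LinearMap.toSpanSingleton Γ(X, V) _ e) he

theorem genEquiv_apply {P : PreMod X} {V : X.Opens} (e : Sections P V)
    (he : Function.Bijective (fun r : Γ(X, V) ↦ r • e)) (r : Γ(X, V)) :
    genEquiv e he r = r • e := rfl

theorem genEquiv_symm_self {P : PreMod X} {V : X.Opens} (e : Sections P V)
    (he : Function.Bijective (fun r : Γ(X, V) ↦ r • e)) : (genEquiv e he).symm e = 1 := by
  rw [LinearEquiv.symm_apply_eq, genEquiv_apply, one_smul]

theorem isInvertible_tensorPre {P Q : PreMod X} (hP : IsInvertible P) (hQ : IsInvertible Q) : IsInvertible (tensorPre P Q) := by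
  intro x
  obtain ⟨U, hxU, e, he⟩ := hP x
  obtain ⟨U', hxU', e', he'⟩ := hQ x
  refine ⟨U ⊓ U', ⟨hxU, hxU'⟩, tensorPreEquiv P Q _ (res P inf_le_left e ⊗ₜ res Q inf_le_right e'),
    fun V h ↦ ?_⟩
  rw [res_tensorPreEquiv_tmul, res_res, res_res]
  let F := (TensorProduct.lid Γ(X, V) Γ(X, V)).symm ≪≫ₗ
    TensorProduct.congr (genEquiv _ (he V (h.trans inf_le_left)))
      (genEquiv _ (he' V (h.trans inf_le_right))) ≪≫ₗ tensorPreEquiv P Q V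
  convert F.bijective using 1
  ext r
  simp only [F, LinearEquiv.trans_apply, TensorProduct.lid_symm_apply,
    TensorProduct.congr_tmul, genEquiv_apply, one_smul, TensorProduct.tmul_smul]
  exact (map_smul (tensorPreEquiv P Q V) r _).symm

theorem locBij_whiskerRight {P Q R : PreMod X} {φ : P ⟶ Q} (hφ : IsLocallyBijective φ) (hR : IsInvertible R) :
    IsLocallyBijective (whiskerRight φ R) := by
  have key (R : PreMod X) {V : X.Opens} {e : Sections R V} (he : Function.Surjective (fun r : Γ(X, V) ↦ r • e))
      (P : PreMod X) (s : Sections (tensorPre P R) V) : ∃ p, s = tensorPreEquiv P R V (p ⊗ₜ e) := by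
    obtain ⟨s, rfl⟩ := (tensorPreEquiv P R V).surjective s
    induction s with
    | zero => exact ⟨0, by simp⟩
    | add a b ha hb =>
      obtain ⟨p, hp⟩ := ha
      obtain ⟨q, hq⟩ := hb
      exact ⟨p + q, by rw [map_add, hp, hq, TensorProduct.add_tmul, map_add]⟩
    | tmul a b =>
      obtain ⟨r, rfl⟩ := he b
      exact ⟨r • a, by rw [TensorProduct.smul_tmul]⟩
  constructor
  · intro U s hs x hx
    obtain ⟨U', hxU', e, he⟩ := hR x
    obtain ⟨p, hp⟩ := key R (he (U ⊓ U') inf_le_right).2 P (res _ inf_le_left s)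
    have h0 := congrArg (res _ (inf_le_left : U ⊓ U' ≤ U)) hs
    rw [← homSec_res, hp, homSec_whiskerRight, map_zero, EmbeddingLike.map_eq_zero_iff] at h0
    have h1 := congrArg (TensorProduct.rid _ _ ∘ TensorProduct.congr (LinearEquiv.refl _ _)
      (genEquiv _ (he (U ⊓ U') inf_le_right)).symm) h0
    simp only [Function.comp_apply, TensorProduct.congr_tmul, LinearEquiv.refl_apply,
      genEquiv_symm_self, TensorProduct.rid_tmul, one_smul, map_zero] at h1
    obtain ⟨V, hV, hxV, hp0⟩ := hφ.inj _ p h1 x ⟨hx, hxU'⟩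
    refine ⟨V, hV.trans inf_le_left, hxV, ?_⟩
    rw [← res_res _ inf_le_left hV, hp, res_tensorPreEquiv_tmul, hp0, TensorProduct.zero_tmul, map_zero]
  · intro U s x hx
    obtain ⟨U', hxU', e, he⟩ := hR x
    obtain ⟨q, hq⟩ := key R (he (U ⊓ U') inf_le_right).2 Q (res _ inf_le_left s)
    obtain ⟨V, hV, hxV, p, hp⟩ := hφ.surj _ q x ⟨hx, hxU'⟩
    refine ⟨V, hV.trans inf_le_left, hxV, tensorPreEquiv P R V (p ⊗ₜ res R hV (res R inf_le_right e)), ?_⟩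
    rw [homSec_whiskerRight, hp, ← res_tensorPreEquiv_tmul, ← hq, res_res]



/-- Functoriality of the associated sheaf, on isomorphisms. -/
def sheafifyIso {P Q : PreMod X} (i : P ≅ Q) : sheafify P ≅ sheafify Q :=
  (PresheafOfModules.sheafification (R := X.ringCatSheaf) (𝟙 X.ringCatSheaf.obj)).mapIso i

/-- A sheaf of modules is isomorphic to its sheafification. -/
def sheafificationIso {C : Type*} [Category* C] {J : GrothendieckTopology C}
    {R : Sheaf J RingCat.{u}} [J.WEqualsLocallyBijective AddCommGrpCat.{u}]
    [HasWeakSheafify J AddCommGrpCat.{u}] (L : SheafOfModules.{u} R) :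
    (PresheafOfModules.sheafification (𝟙 R.obj)).obj L.val ≅ L :=
  (asIso (PresheafOfModules.sheafificationAdjunction (𝟙 R.obj)).counit).app L

/-- A sheaf of modules is isomorphic to its sheafification. -/
def sheafifyToPreMod (L : X.Modules) : sheafify (toPreMod L) ≅ L :=
  sheafificationIso (R := X.ringCatSheaf) L

/-- Isomorphic sheaves have isomorphic underlying presheaves. -/
def toPreModIso {L L' : X.Modules} (i : L ≅ L') : toPreMod L ≅ toPreMod L' :=
  (SheafOfModules.forget X.ringCatSheaf).mapIso i

/-- Functoriality of the presheaf tensor product, on isomorphisms. -/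
def tensorPreIso {P P' Q Q' : PreMod X} (i : P ≅ P') (j : Q ≅ Q') : tensorPre P Q ≅ tensorPre P' Q' :=
  MonoidalCategory.tensorIso i j

/-- Commutativity of the presheaf tensor product. -/
def tensorPreComm (P Q : PreMod X) : tensorPre P Q ≅ tensorPre Q P := BraidedCategory.braiding (C := PreMod X) P Q

/-- Associativity of the presheaf tensor product. -/
def tensorPreAssoc (P Q R : PreMod X) : tensorPre (tensorPre P Q) R ≅ tensorPre P (tensorPre Q R) :=
  MonoidalCategory.associator (C := PreMod X) P Q R

/-- `𝒪_X` as a module over itself. -/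
def unitSheaf (X : Scheme.{u}) : X.Modules := SheafOfModules.unit X.ringCatSheaf

/-- `𝒪_X ⊗ P ≅ P`. -/
def unitTensorPre (P : PreMod X) : tensorPre (toPreMod (unitSheaf X)) P ≅ P :=
  MonoidalCategory.leftUnitor (C := PreMod X) P

theorem isInvertible_unitSheaf (X : Scheme.{u}) : IsInvertible (toPreMod (unitSheaf X)) := by
  intro x
  refine ⟨⊤, trivial, show Sections (toPreMod (unitSheaf X)) ⊤ from (1 : Γ(X, ⊤)), fun V h ↦ ?_⟩
  suffices (fun r : Γ(X, V) ↦ (r * (X.presheaf.map (homOfLE h).op).hom 1 : Γ(X, V))) = id by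
    change Function.Bijective
      (fun r : Γ(X, V) ↦ (r * (X.presheaf.map (homOfLE h).op).hom 1 : Γ(X, V)))
    rw [this]
    exact Function.bijective_id
  funext r
  rw [map_one, mul_one, id]

theorem tensor_assoc_aux {P Q : PreMod X} (hQ : IsInvertible Q) :
    Nonempty (sheafify (tensorPre P Q) ≅ sheafify (tensorPre (toPreMod (sheafify P)) Q)) :=
  (locBij_whiskerRight (locBij_toSheafification P) hQ).nonempty_iso

/-- Invertible sheaves on `X`. -/
def InvertibleSheaf (X : Scheme.{u}) : Type (u + 1) := {L : X.Modules // IsInvertible (toPreMod L)}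

instance invertibleSheafSetoid (X : Scheme.{u}) : Setoid (InvertibleSheaf X) where
  r L L' := Nonempty (L.1 ≅ L'.1)
  iseqv := ⟨fun _ ↦ ⟨Iso.refl _⟩, fun ⟨i⟩ ↦ ⟨i.symm⟩, fun ⟨i⟩ ⟨j⟩ ↦ ⟨i ≪≫ j⟩⟩

/-- Isomorphism classes of invertible sheaves on `X`. -/
def InvertibleClass (X : Scheme.{u}) : Type (u + 1) :=
  _root_.Quotient (invertibleSheafSetoid X)

/-- The isomorphism class of an invertible sheaf. -/
def InvertibleSheaf.cls (L : InvertibleSheaf X) : InvertibleClass X := Quotient.mk _ L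

/-- The product of classes is the class of the tensor product. -/
instance (X : Scheme.{u}) : CommMonoid (InvertibleClass X) where
  mul := Quotient.map₂ (fun L L' ↦ ⟨tensor L.1 L'.1, isInvertible_sheafify (isInvertible_tensorPre L.2 L'.2)⟩)
    fun _ _ ⟨i⟩ _ _ ⟨j⟩ ↦ ⟨sheafifyIso (tensorPreIso (toPreModIso i) (toPreModIso j))⟩
  one := ⟦⟨unitSheaf X, isInvertible_unitSheaf X⟩⟧
  mul_comm := by
    rintro ⟨L⟩ ⟨L'⟩
    exact Quotient.sound ⟨sheafifyIso (tensorPreComm _ _)⟩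
  mul_assoc := by
    rintro ⟨L⟩ ⟨L'⟩ ⟨L''⟩
    obtain ⟨i⟩ := tensor_assoc_aux (P := tensorPre (toPreMod L.1) (toPreMod L'.1)) L''.2
    obtain ⟨j⟩ := tensor_assoc_aux (P := tensorPre (toPreMod L'.1) (toPreMod L''.1)) L.2
    exact Quotient.sound ⟨i.symm ≪≫ sheafifyIso (tensorPreAssoc _ _ _) ≪≫ sheafifyIso (tensorPreComm _ _) ≪≫ j ≪≫
      sheafifyIso (tensorPreComm _ _)⟩
  one_mul := by
    rintro ⟨L⟩
    exact Quotient.sound ⟨sheafifyIso (unitTensorPre _) ≪≫ sheafifyToPreMod _⟩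
  mul_one := by
    rintro ⟨L⟩
    exact Quotient.sound ⟨sheafifyIso (tensorPreComm _ _) ≪≫ sheafifyIso (unitTensorPre _) ≪≫ sheafifyToPreMod _⟩

theorem InvertibleSheaf.cls_eq {L L' : InvertibleSheaf X} (i : L.1 ≅ L'.1) : L.cls = L'.cls :=
  Quotient.sound ⟨i⟩

/-- The Picard group: isomorphism classes of invertible sheaves under the tensor product. (Every
class is invertible, the inverse being the class of the dual; taking units of the monoid of all
classes makes the group structure immediate.) -/
abbrev Pic (X : Scheme.{u}) := (InvertibleClass X)ˣ


/-! ### Cartier divisors on integral schemes -/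

section Cartier

variable [IsIntegral X]

/-- The value of a regular function in the function field, computed through the stalk at `x`. -/
def evalAt {U : X.Opens} (x : U) : Γ(X, U) →+* X.functionField :=
  (algebraMap (X.presheaf.stalk x.1) X.functionField).comp (X.presheaf.germ U x.1 x.2).hom

theorem evalAt_injective {U : X.Opens} (x : U) : Function.Injective (evalAt x) :=
  (IsFractionRing.injective (X.presheaf.stalk x.1) X.functionField).comp
    (germ_injective_of_isIntegral X x.1 x.2)

theorem evalAt_eq {U : X.Opens} (x y : U) (r : Γ(X, U)) : evalAt x r = evalAt y r := by
  have : Nonempty U := ⟨x⟩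
  exact (Scheme.algebraMap_germ_eq_germToFunctionField X x.2 r).trans
    (Scheme.algebraMap_germ_eq_germToFunctionField X y.2 r).symm

theorem evalAt_resO {U V : X.Opens} (h : V ≤ U) (x : V) (r : Γ(X, U)) :
    evalAt x (resO h r) = evalAt (⟨x.1, h x.2⟩ : U) r :=
  congrArg (algebraMap (X.presheaf.stalk x.1) X.functionField)
    (X.presheaf.germ_res_apply (homOfLE h) x.1 x.2 r)

variable (X) in
/-- The units of the local ring at `x`, as a subgroup of the units of the function field. -/
def stalkUnits (x : X) : Subgroup X.functionFieldˣ :=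
  (Units.map (algebraMap (X.presheaf.stalk x) X.functionField).toMonoidHom).range

variable (X) in
/-- The class of a nonzero rational function modulo the units of the local ring at `x`. -/
def germDiv (x : X) : X.functionFieldˣ →* X.functionFieldˣ ⧸ stalkUnits X x :=
  QuotientGroup.mk' (stalkUnits X x)

variable (X) in
/-- The global sections of the sheaf `𝒦ˣ/𝒪ˣ`, as families of elements of its stalks `K(X)ˣ/𝒪_{X,x}ˣ`
that are locally induced by a nonzero rational function. -/
def cartierSubgroup : AddSubgroup (∀ x : X, Additive (X.functionFieldˣ ⧸ stalkUnits X x)) where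
  carrier := {D | ∀ x : X, ∃ U : X.Opens, x ∈ U ∧ ∃ f : X.functionFieldˣ,
    ∀ y ∈ U, D y = Additive.ofMul (germDiv X y f)}
  zero_mem' x := ⟨⊤, trivial, 1, fun y _ ↦ by simp⟩
  add_mem' {D D'} hD hD' x := by
    obtain ⟨U, hxU, f, hf⟩ := hD x
    obtain ⟨V, hxV, g, hg⟩ := hD' x
    exact ⟨U ⊓ V, ⟨hxU, hxV⟩, f * g, fun y hy ↦ by
      rw [Pi.add_apply, hf y hy.1, hg y hy.2, map_mul, ofMul_mul]⟩
  neg_mem' {D} hD x := by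
    obtain ⟨U, hxU, f, hf⟩ := hD x
    exact ⟨U, hxU, f⁻¹, fun y hy ↦ by rw [Pi.neg_apply, hf y hy, map_inv, ofMul_inv]⟩

variable (X) in
/-- The group of Cartier divisors of an integral scheme. -/
def CaDiv : Type u := cartierSubgroup X

instance : AddCommGroup (CaDiv X) := inferInstanceAs (AddCommGroup (cartierSubgroup X))

namespace CaDiv

variable (D : CaDiv X)

/-- `f` is an equation of `D` at `x`. -/
def IsLocalEquation (x : X) (f : X.functionFieldˣ) : Prop :=
  D.1 x = Additive.ofMul (germDiv X x f)

theorem IsLocalEquation.mul_iff {D : CaDiv X} {x : X} {f : X.functionFieldˣ} (hf : D.IsLocalEquation x f)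
    (g : X.functionField) :
    (∀ f', D.IsLocalEquation x f' → g * f' ∈
      (algebraMap (X.presheaf.stalk x) X.functionField).range) ↔
      g * f ∈ (algebraMap (X.presheaf.stalk x) X.functionField).range := by
  refine ⟨fun h ↦ h f hf, fun h f' hf' ↦ ?_⟩
  have : germDiv X x f = germDiv X x f' := Additive.ofMul.injective (hf.symm.trans hf')
  obtain ⟨u, hu⟩ := QuotientGroup.eq.1 this
  have : f' = f * Units.map (algebraMap (X.presheaf.stalk x) X.functionField).toMonoidHom u := by
    rw [hu, mul_inv_cancel_left]
  rw [this, Units.val_mul (α := X.functionField), ← mul_assoc]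
  exact mul_mem h ⟨u.1, rfl⟩

/-- The sections of `𝒪_X(D)` over `U`: locally constant functions `s` from `U` to the function field
(i.e. sections over `U` of the constant sheaf) such that `s f` is regular at `x` whenever `x ∈ U` and
`f` is an equation of `D` at `x`. So `𝒪_X(D)` is `f⁻¹ 𝒪_U` wherever `D` has equation `f`. -/
def sections (U : X.Opens) : AddSubgroup (U → X.functionField) where
  carrier := {s | IsLocallyConstant s ∧ ∀ (x : U) (f : X.functionFieldˣ),
    D.IsLocalEquation x.1 f →
      s x * f ∈ (algebraMap (X.presheaf.stalk x.1) X.functionField).range}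
  zero_mem' := ⟨IsLocallyConstant.const 0, fun x f _ ↦ by simp⟩
  add_mem' {s t} hs ht := ⟨hs.1.add ht.1, fun x f hf ↦ by
    rw [Pi.add_apply, add_mul]
    exact add_mem (hs.2 x f hf) (ht.2 x f hf)⟩
  neg_mem' {s} hs := ⟨hs.1.neg, fun x f hf ↦ by
    rw [Pi.neg_apply, neg_mul]
    exact neg_mem (hs.2 x f hf)⟩

instance (U : X.Opens) : Module Γ(X, U) (D.sections U) where
  smul r s := ⟨fun x ↦ evalAt x r * s.1 x, by
    refine ⟨?_, fun x f hf ↦ ?_⟩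
    · have : IsLocallyConstant (fun x : U ↦ evalAt x r) :=
        IsLocallyConstant.of_constant _ fun x y ↦ evalAt_eq x y r
      exact this.mul s.2.1
    · rw [mul_assoc]
      exact mul_mem ⟨_, rfl⟩ (s.2.2 x f hf)⟩
  one_smul s := Subtype.ext (funext fun x ↦ by
    change evalAt x 1 * s.1 x = s.1 x
    rw [map_one, one_mul])
  mul_smul r r' s := Subtype.ext (funext fun x ↦ by
    change evalAt x (r * r') * s.1 x = evalAt x r * (evalAt x r' * s.1 x)
    rw [map_mul, mul_assoc])
  smul_zero r := Subtype.ext (funext fun x ↦ mul_zero _)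
  smul_add r s t := Subtype.ext (funext fun x ↦ mul_add _ _ _)
  add_smul r r' s := Subtype.ext (funext fun x ↦ by
    change evalAt x (r + r') * s.1 x = evalAt x r * s.1 x + evalAt x r' * s.1 x
    rw [map_add, add_mul])
  zero_smul s := Subtype.ext (funext fun x ↦ by
    change evalAt x 0 * s.1 x = 0
    rw [map_zero, zero_mul])

variable {D} in
theorem smul_apply {U : X.Opens} (r : Γ(X, U)) (s : D.sections U) (x : U) :
    (r • s).1 x = evalAt x r * s.1 x := rfl

/-- Restriction of sections of `𝒪_X(D)`. -/
def restrict {U V : X.Opens} (h : V ≤ U) : D.sections U →+ D.sections V where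
  toFun s := ⟨fun x ↦ s.1 ⟨x.1, h x.2⟩,
    s.2.1.comp_continuous (continuous_inclusion h), fun x f hf ↦ s.2.2 ⟨x.1, h x.2⟩ f hf⟩
  map_zero' := rfl
  map_add' _ _ := rfl

/-- Membership in `sections` is a local condition. -/
def localPredicate : TopCat.LocalPredicate (X := X) (fun _ ↦ (X.functionField : Type u)) where
  pred {U} s := s ∈ D.sections U
  res {U V} i s hs := (D.restrict i.le ⟨s, hs⟩).2
  locality {U} s hs := by
    refine ⟨?_, fun x f hf ↦ ?_⟩
    · refine (IsLocallyConstant.iff_eventually_eq s).2 fun x ↦ ?_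
      obtain ⟨V, hxV, i, hV⟩ := hs x
      have h1 := (IsLocallyConstant.iff_eventually_eq _).1 hV.1 ⟨x.1, hxV⟩
      have hemb : Topology.IsOpenEmbedding (Set.inclusion i.le) :=
        Opens.isOpenEmbedding_of_le i.le
      exact (hemb.map_nhds_eq ⟨x.1, hxV⟩) ▸ (Filter.eventually_map.2 h1)
    · obtain ⟨V, hxV, i, hV⟩ := hs x
      exact hV.2 ⟨x.1, hxV⟩ f hf

/-- The presheaf of abelian groups `U ↦ Γ(U, 𝒪_X(D))`. -/
def presheafAb : TopCat.Presheaf Ab.{u} X where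
  obj U := AddCommGrpCat.of (D.sections U.unop)
  map i := AddCommGrpCat.ofHom (D.restrict i.unop.le)

theorem isSheaf_presheafAb : D.presheafAb.IsSheaf :=
  (TopCat.Presheaf.isSheaf_iff_isSheaf_comp (forget Ab) _).2
    (TopCat.subpresheafToTypes.isSheaf D.localPredicate)

/-- The `𝒪_X`-module `𝒪_X(D)`. -/
def sheaf : X.Modules :=
  { val :=
      letI : ∀ U : (Opens X)ᵒᵖ, Module (X.ringCatSheaf.obj.obj U) (D.presheafAb.obj U) :=
        fun U ↦ inferInstanceAs (Module Γ(X, U.unop) (D.sections U.unop))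
      PresheafOfModules.ofPresheaf D.presheafAb (fun _ _ f r _ ↦ Subtype.ext (funext fun x ↦
        congrArg (· * _) (evalAt_resO f.unop.le x r).symm))
    isSheaf := D.isSheaf_presheafAb }


variable {D} in
theorem IsLocalEquation.add {D' : CaDiv X} {x : X} {f g : X.functionFieldˣ}
    (hf : D.IsLocalEquation x f) (hg : D'.IsLocalEquation x g) :
    (D + D').IsLocalEquation x (f * g) := by
  change D.1 x + D'.1 x = _
  rw [hf, hg, map_mul, ofMul_mul]

theorem exists_localEquation (x : X) : ∃ (U : X.Opens) (f : X.functionFieldˣ), x ∈ U ∧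
    ∀ y ∈ U, D.IsLocalEquation y f := by
  obtain ⟨U, hxU, f, hf⟩ := D.2 x
  exact ⟨U, f, hxU, hf⟩

theorem sections_const {D : CaDiv X} {U : X.Opens} (s : D.sections U) (x y : U) :
    s.1 x = s.1 y := by
  have : PreconnectedSpace {x // x ∈ U} := Subtype.preconnectedSpace
    ((PreirreducibleSpace.isPreirreducible_univ (X := X)).open_subset U.isOpen
      (Set.subset_univ _)).isPreconnected
  exact s.2.1.apply_eq_of_preconnectedSpace x y

/-- The section `f⁻¹` of `𝒪_X(D)` on an open set where `f` is an equation of `D`. -/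
def gen {D : CaDiv X} {U : X.Opens} {f : X.functionFieldˣ} (hf : ∀ y ∈ U, D.IsLocalEquation y f) :
    D.sections U :=
  ⟨fun _ ↦ ((f⁻¹ : X.functionFieldˣ) : X.functionField), IsLocallyConstant.const _,
    fun x ↦ ((hf x.1 x.2).mul_iff _).2 ⟨1, by rw [map_one, Units.inv_mul]⟩⟩

theorem exists_evalAt_eq {U : X.Opens} (s : U → X.functionField) (hc : ∀ x y, s x = s y)
    (hs : ∀ x : U, s x ∈ (algebraMap (X.presheaf.stalk x.1) X.functionField).range) :
    ∃ r : Γ(X, U), ∀ x : U, evalAt x r = s x := by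
  have key (x : U) : ∃ (W : X.Opens) (h : W ≤ U) (r : Γ(X, W)) (hx : x.1 ∈ W),
      evalAt (⟨x.1, hx⟩ : W) r = s x := by
    obtain ⟨g, hg⟩ := hs x
    obtain ⟨W, hxW, r, rfl⟩ := X.presheaf.exists_germ_eq g
    refine ⟨W ⊓ U, inf_le_right, resO inf_le_left r, ⟨hxW, x.2⟩, ?_⟩
    rw [evalAt_resO, ← hg]
    rfl
  choose W hW r hx hr using key
  obtain ⟨r₀, hr₀⟩ := resO_glue W hW hx r (fun x y ↦ by
    by_cases hne : ∃ z, z ∈ W x ⊓ W y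
    · obtain ⟨z, hz⟩ := hne
      refine evalAt_injective (⟨z, hz⟩ : {z // z ∈ W x ⊓ W y}) ?_
      rw [evalAt_resO, evalAt_resO]
      refine (evalAt_eq _ ⟨x.1, hx x⟩ _).trans (((hr x).trans (hc x y)).trans ?_)
      exact (hr y).symm.trans (evalAt_eq _ _ _)
    · exact resO_ext _ _ fun z hz ↦ (hne ⟨z, hz⟩).elim)
  refine ⟨r₀, fun x ↦ ?_⟩
  rw [← hr x, ← hr₀ x, evalAt_resO]

theorem gen_bijective {D : CaDiv X} {U : X.Opens} {f : X.functionFieldˣ}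
    (hf : ∀ y ∈ U, D.IsLocalEquation y f) :
    Function.Bijective (fun r : Γ(X, U) ↦ r • gen hf) := by
  constructor
  · intro r r' h
    refine resO_ext _ _ fun x hx ↦ ?_
    have : evalAt ⟨x, hx⟩ r * ((f⁻¹ : X.functionFieldˣ) : X.functionField) =
      evalAt ⟨x, hx⟩ r' * ((f⁻¹ : X.functionFieldˣ) : X.functionField) :=
      congrFun (congrArg Subtype.val h) ⟨x, hx⟩
    have h' : r = r' := evalAt_injective ⟨x, hx⟩ (mul_right_cancel₀ (Units.ne_zero _) this)
    exact ⟨U, le_rfl, hx, by rw [h']⟩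
  · intro s
    obtain ⟨r, hr⟩ := exists_evalAt_eq (fun x ↦ s.1 x * f)
      (fun x y ↦ congrArg (· * _) (sections_const s x y))
      (fun x ↦ s.2.2 x f (hf x.1 x.2))
    refine ⟨r, Subtype.ext (funext fun x ↦ ?_)⟩
    change evalAt x r * _ = _
    rw [hr x]
    exact Units.mul_inv_cancel_right (α := X.functionField) _ _

theorem isInvertible_sheaf : IsInvertible (toPreMod D.sheaf) := by
  intro x
  obtain ⟨U, f, hxU, hf⟩ := D.exists_localEquation x
  exact ⟨U, hxU, gen hf, fun V h ↦ gen_bijective (fun y hy ↦ hf y (h hy))⟩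

/-- `𝒪_X(D)` as an invertible sheaf. -/
def invertibleSheaf : InvertibleSheaf X := ⟨D.sheaf, D.isInvertible_sheaf⟩

/-- Multiplication of sections inside the function field. -/
def mulSections {D D' : CaDiv X} {U : X.Opens} (s : D.sections U) (t : D'.sections U) :
    (D + D').sections U :=
  ⟨fun x ↦ s.1 x * t.1 x, s.2.1.mul t.2.1, fun x ↦ by
    obtain ⟨U, f, hxU, hf⟩ := D.exists_localEquation x.1
    obtain ⟨V, g, hxV, hg⟩ := D'.exists_localEquation x.1
    rw [((hf x.1 hxU).add (hg x.1 hxV)).mul_iff, Units.val_mul (α := X.functionField), mul_mul_mul_comm]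
    exact mul_mem (s.2.2 x f (hf x.1 hxU)) (t.2.2 x g (hg x.1 hxV))⟩


theorem mulSections_smul_left {D D' : CaDiv X} {U : X.Opens} (r : Γ(X, U)) (s : D.sections U)
    (t : D'.sections U) : mulSections (r • s) t = r • mulSections s t :=
  Subtype.ext (funext fun _ ↦ mul_assoc _ _ _)

theorem mulSections_smul_right {D D' : CaDiv X} {U : X.Opens} (r : Γ(X, U)) (s : D.sections U)
    (t : D'.sections U) : mulSections s (r • t) = r • mulSections s t :=
  Subtype.ext (funext fun _ ↦ mul_left_comm _ _ _)

/-- Multiplication of sections, as a bilinear map. -/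
def mulLinear (D D' : CaDiv X) (U : X.Opens) :
    D.sections U →ₗ[Γ(X, U)] D'.sections U →ₗ[Γ(X, U)] (D + D').sections U :=
  LinearMap.mk₂ Γ(X, U) mulSections
    (fun _ _ _ ↦ Subtype.ext (funext fun _ ↦ add_mul _ _ _)) mulSections_smul_left
    (fun _ _ _ ↦ Subtype.ext (funext fun _ ↦ mul_add _ _ _)) mulSections_smul_right

/-- Multiplication of sections, on the tensor product. -/
def mulTensorPre (D D' : CaDiv X) (U : X.Opens) :
    Sections (tensorPre (toPreMod D.sheaf) (toPreMod D'.sheaf)) U →ₗ[Γ(X, U)] Sections (toPreMod (D + D').sheaf) U :=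
  (TensorProduct.lift (mulLinear D D' U) ∘ₗ (tensorPreEquiv (toPreMod D.sheaf) (toPreMod D'.sheaf) U).symm.toLinearMap :)

theorem mulTens_res (D D' : CaDiv X) {U V : X.Opens} (h : V ≤ U)
    (s : Sections (tensorPre (toPreMod D.sheaf) (toPreMod D'.sheaf)) U) :
    mulTensorPre D D' V (res _ h s) = res _ h (mulTensorPre D D' U s) := by
  obtain ⟨s, rfl⟩ := (tensorPreEquiv _ _ U).surjective s
  induction s with
  | zero => simp only [map_zero]
  | add a b ha hb => simp only [map_add, ha, hb]
  | tmul a b => rfl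

/-- Multiplication of sections, as a morphism from the presheaf tensor product. -/
def mulHom (D D' : CaDiv X) : tensorPre (toPreMod D.sheaf) (toPreMod D'.sheaf) ⟶ toPreMod (D + D').sheaf :=
  homOfSections (mulTensorPre D D') (mulTens_res D D')

theorem mulHom_locBij (D D' : CaDiv X) : IsLocallyBijective (mulHom D D') := by
  refine IsLocallyBijective.of_generators _ fun x ↦ ?_
  obtain ⟨U, f, hxU, hf⟩ := D.exists_localEquation x
  obtain ⟨U', f', hxU', hf'⟩ := D'.exists_localEquation x
  refine ⟨U ⊓ U', ⟨hxU, hxU'⟩, fun V hV ↦ ?_⟩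
  have hf : ∀ y ∈ V, D.IsLocalEquation y f := fun y hy ↦ hf y (hV hy).1
  have hf' : ∀ y ∈ V, D'.IsLocalEquation y f' := fun y hy ↦ hf' y (hV hy).2
  have hff : ∀ y ∈ V, (D + D').IsLocalEquation y (f * f') := fun y hy ↦ (hf y hy).add (hf' y hy)
  let E : Γ(X, V) ≃ₗ[Γ(X, V)] Sections (tensorPre (toPreMod D.sheaf) (toPreMod D'.sheaf)) V :=
    (TensorProduct.lid Γ(X, V) Γ(X, V)).symm ≪≫ₗ TensorProduct.congr
      (genEquiv (P := toPreMod D.sheaf) (gen hf) (gen_bijective hf))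
      (genEquiv (P := toPreMod D'.sheaf) (gen hf') (gen_bijective hf')) ≪≫ₗ tensorPreEquiv _ _ V
  refine (Function.Bijective.of_comp_iff _ E.bijective).1 ?_
  suffices homSections (mulHom D D') V ∘ E = fun r ↦ (r • gen hff : (D + D').sections V) by
    rw [this]
    exact gen_bijective hff
  funext r
  refine Subtype.ext (funext fun y ↦ ?_)
  change (evalAt y 1 * (f⁻¹ : X.functionFieldˣ)) * (evalAt y r * (f'⁻¹ : X.functionFieldˣ)) =
    evalAt y r * ((f * f')⁻¹ : X.functionFieldˣ)
  rw [map_one, one_mul, mul_inv, Units.val_mul (α := X.functionField), mul_left_comm]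

theorem cls_add (D D' : CaDiv X) : (D + D').invertibleSheaf.cls =
    D.invertibleSheaf.cls * D'.invertibleSheaf.cls := by
  obtain ⟨i⟩ := (mulHom_locBij D D').nonempty_iso
  exact (InvertibleSheaf.cls_eq (L := ⟨tensor D.sheaf D'.sheaf, _⟩) (i ≪≫ sheafifyToPreMod _)).symm

/-- The morphism `𝒪_X → 𝒪_X(0)`. -/
def unitHom : toPreMod (unitSheaf X) ⟶ toPreMod (0 : CaDiv X).sheaf :=
  homOfSections (fun U ↦ (LinearMap.toSpanSingleton Γ(X, U) (Sections (toPreMod (0 : CaDiv X).sheaf) U)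
    (gen (f := 1) fun _ _ ↦ rfl) :)) fun h r ↦ Subtype.ext (funext fun x ↦
      congrArg (· * _) (evalAt_resO h x r))

theorem cls_zero : (0 : CaDiv X).invertibleSheaf.cls = 1 := by
  have : IsLocallyBijective (unitHom (X := X)) := IsLocallyBijective.of_generators _ fun x ↦
    ⟨⊤, trivial, fun V _ ↦ gen_bijective (D := 0) (f := 1) (fun _ _ ↦ rfl)⟩
  obtain ⟨i⟩ := this.nonempty_iso
  exact (InvertibleSheaf.cls_eq (L := ⟨unitSheaf X, isInvertible_unitSheaf X⟩)
    ((sheafifyToPreMod _).symm ≪≫ i ≪≫ sheafifyToPreMod _)).symm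

/-- The class `[D]` of `𝒪_X(D)` in the Picard group. -/
def toPic : CaDiv X →+ Additive (Pic X) where
  toFun D := Additive.ofMul ⟨D.invertibleSheaf.cls, (-D).invertibleSheaf.cls,
    by rw [← cls_add, add_neg_cancel, cls_zero], by rw [← cls_add, neg_add_cancel, cls_zero]⟩
  map_zero' := Additive.toMul.injective (Units.ext cls_zero)
  map_add' D D' := Additive.toMul.injective (Units.ext (cls_add D D'))

end CaDiv

end Cartier

/-! ### Sheaves of graded algebras -/

/-- A sheaf of commutative `𝒪_X`-algebras. -/
structure AlgebraSheaf (X : Scheme.{u}) where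
  presheaf : TopCat.Presheaf CommRingCat.{u} X
  isSheaf : presheaf.IsSheaf
  structureHom : X.presheaf ⟶ presheaf

namespace AlgebraSheaf

variable (R : AlgebraSheaf X)

/-- The ring of sections over `U`. -/
def sections (U : X.Opens) : Type u := R.presheaf.obj (op U)

instance (U : X.Opens) : CommRing (R.sections U) :=
  inferInstanceAs (CommRing (R.presheaf.obj (op U)))

instance (U : X.Opens) : Algebra Γ(X, U) (R.sections U) :=
  RingHom.toAlgebra (S := R.sections U) (R.structureHom.app (op U)).hom

/-- The restriction map. -/
def restrict {U V : X.Opens} (h : V ≤ U) : R.sections U →+* R.sections V :=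
  (R.presheaf.map (homOfLE h).op).hom

end AlgebraSheaf

open scoped Classical in
/-- A sheaf of `M`-graded (commutative) `𝒪_X`-algebras: over every open set the algebra of sections
is `M`-graded, and the restriction maps preserve the degree. -/
structure GradedAlgebraSheaf (X : Scheme.{u}) (M : Type u) [AddCommGroup M] extends
    AlgebraSheaf X where
  deg : ∀ U : X.Opens, M → Submodule Γ(X, U) (toAlgebraSheaf.sections U)
  gradedMonoid : ∀ U, SetLike.GradedMonoid (deg U)
  isInternal : ∀ U, DirectSum.IsInternal (deg U)
  restrict_mem : ∀ {U V : X.Opens} (h : V ≤ U) (m : M) (s : toAlgebraSheaf.sections U),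
    s ∈ deg U m → toAlgebraSheaf.restrict h s ∈ deg V m

namespace GradedAlgebraSheaf

variable {M : Type u} [AddCommGroup M] (R : GradedAlgebraSheaf X M)

/-- The restriction map of the degree-`m`-part. -/
def restrictDeg {U V : X.Opens} (h : V ≤ U) {m : M} (s : R.deg U m) : R.deg V m :=
  ⟨R.restrict h s.1, R.restrict_mem h m s.1 s.2⟩

/-- The product of homogeneous sections. -/
def mulDeg {U : X.Opens} {m n : M} (s : R.deg U m) (t : R.deg U n) : R.deg U (m + n) :=
  ⟨s.1 * t.1, (R.gradedMonoid U).mul_mem s.2 t.2⟩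

/-- A morphism of sheaves of `M`-graded `𝒪_X`-algebras. -/
@[ext]
structure Hom (R R' : GradedAlgebraSheaf X M) where
  hom : R.presheaf ⟶ R'.presheaf
  structureHom_comp : R.structureHom ≫ hom = R'.structureHom
  map_mem : ∀ (U : X.Opens) (m : M) (s : R.sections U), s ∈ R.deg U m →
    ((hom.app (op U)).hom s : R'.sections U) ∈ R'.deg U m

instance : Category (GradedAlgebraSheaf X M) where
  Hom := Hom
  id R := ⟨𝟙 _, Category.comp_id _, fun _ _ _ hs ↦ hs⟩
  comp φ ψ := ⟨φ.hom ≫ ψ.hom, by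
    rw [← Category.assoc, φ.structureHom_comp, ψ.structureHom_comp],
    fun U m s hs ↦ ψ.map_mem U m _ (φ.map_mem U m s hs)⟩
  id_comp _ := Hom.ext (Category.id_comp _)
  comp_id _ := Hom.ext (Category.comp_id _)
  assoc _ _ _ := Hom.ext (Category.assoc _ _ _)

end GradedAlgebraSheaf

/-! ### Cox sheaves -/

/-- The constants: the map from `k` to the regular functions on an open subset of a `k`-scheme. -/
def constants {k : Type u} [Field k] (f : X ⟶ Spec (CommRingCat.of k)) (U : X.Opens) :
    k →+* Γ(X, U) :=
  (resO (le_top : U ≤ ⊤)).comp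
    (f.appTop.hom.comp (Scheme.ΓSpecIso (CommRingCat.of k)).inv.hom)

section Cox

variable {k : Type u} [Field k] [IsIntegral X] {M : Type u} [AddCommGroup M]

/-- The group of pairs `(m, D)` of an element of `M` and a Cartier divisor with `[D] = lam m`. -/
def gradedDiv (lam : M →+ Additive (Pic X)) : AddSubgroup (M × CaDiv X) :=
  AddMonoidHom.eqLocus (CaDiv.toPic.comp (AddMonoidHom.snd M (CaDiv X)))
    (lam.comp (AddMonoidHom.fst M (CaDiv X)))

/-- A Cox sheaf of type `lam` on the integral `k`-scheme `f : X ⟶ Spec k`: a sheaf of `M`-graded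
`𝒪_X`-algebras with isomorphisms of `𝒪_X`-modules from its degree-`m`-part to `𝒪_X(D)` for all
`(m, D)` with `[D] = lam m`, which are multiplicative up to nonzero constants from `k`. -/
structure CoxSheaf (f : X ⟶ Spec (CommRingCat.of k)) (lam : M →+ Additive (Pic X)) extends
    GradedAlgebraSheaf X M where
  coxIso : ∀ (p : gradedDiv lam) (U : X.Opens), deg U p.1.1 ≃ₗ[Γ(X, U)] p.1.2.sections U
  coxIso_restrict : ∀ (p : gradedDiv lam) {U V : X.Opens} (h : V ≤ U) (s : deg U p.1.1),
    coxIso p V (toGradedAlgebraSheaf.restrictDeg h s) = p.1.2.restrict h (coxIso p U s)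
  coxIso_mul : ∀ p q : gradedDiv lam, ∃ α : k, α ≠ 0 ∧
    ∀ (U : X.Opens) (s : deg U p.1.1) (t : deg U q.1.1),
      CaDiv.mulSections (coxIso p U s) (coxIso q U t) =
        constants f U α • coxIso (p + q) U (toGradedAlgebraSheaf.mulDeg s t)

/-- A morphism of Cox sheaves of type `lam` is a morphism of sheaves of `M`-graded
`𝒪_X`-algebras. -/
instance (f : X ⟶ Spec (CommRingCat.of k)) (lam : M →+ Additive (Pic X)) :
    Category (CoxSheaf f lam) where
  Hom R R' := R.toGradedAlgebraSheaf ⟶ R'.toGradedAlgebraSheaf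
  id R := 𝟙 R.toGradedAlgebraSheaf
  comp {R R' R''} (φ : R.toGradedAlgebraSheaf ⟶ R'.toGradedAlgebraSheaf)
    (ψ : R'.toGradedAlgebraSheaf ⟶ R''.toGradedAlgebraSheaf) := φ ≫ ψ
  id_comp {R R'} (φ : R.toGradedAlgebraSheaf ⟶ R'.toGradedAlgebraSheaf) := Category.id_comp φ
  comp_id {R R'} (φ : R.toGradedAlgebraSheaf ⟶ R'.toGradedAlgebraSheaf) := Category.comp_id φ
  assoc {R R' S T} (φ : R.toGradedAlgebraSheaf ⟶ R'.toGradedAlgebraSheaf)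
    (ψ : R'.toGradedAlgebraSheaf ⟶ S.toGradedAlgebraSheaf)
    (χ : S.toGradedAlgebraSheaf ⟶ T.toGradedAlgebraSheaf) := Category.assoc φ ψ χ

end Cox

end CoxSheaves

end

/-!
Write `K` for the function field of `X`, `L` for its algebraic closure, and `G` for the group of
pairs `(m, D)` with `[D] = λ(m)`.

Three facts about Cartier divisors on `X` are used. Every isomorphism `𝒪_X(D) ≅ 𝒪_X(D')` is
multiplication by some `h ∈ Kˣ` with `D = D' + div h` (`CaDiv.exists_mul_of_equiv`); hence `D` and
`D'` have the same class only if they differ by a principal divisor, and by the assumption on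
global units `h` is unique up to a constant (`exists_const_of_principal_eq`). Every invertible
sheaf embeds into the constant sheaf `K`, so every class in `Pic X` comes from a Cartier divisor
(`CaDiv.toPic_surjective`).

*Existence.* The homomorphism `(0, div h) ↦ h⁻¹` from a subgroup of `G` to `Lˣ / kˣ` extends to
all of `G`, because `Lˣ / kˣ` is divisible (`nonempty_coxCharacter`). Let `c (m, D) ∈ Lˣ` be
representatives of the values. The subgroup `c (m, D)⁻¹ 𝒪_X(D)` of `L` then depends on `m` only,
and these subgroups are the homogeneous parts of a sheaf of subrings of the group algebra `L[M]`.
This is a Cox sheaf (`CoxCharacter.coxSheaf`). The direct sum over `M` needs no sheafification: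
`X` is irreducible, so that the sections over a nonempty open set are constant functions with
values in `L[M]`. The ring axioms are inherited from `L[M]`.

*Uniqueness.* Choosing a divisor `D` with `(m, D) ∈ G` for each `m`, the isomorphisms of two Cox
sheaves with `𝒪_X(D)` give isomorphisms `φ m` between their homogeneous parts, and `φ m s * φ n t`
is `φ (m + n) (s * t)` up to a constant `a m n ∈ kˣ` (`CoxSheaf.exists_equiv`). Here `a` is a
symmetric `2`-cocycle. It defines an abelian extension of `M` by `kˣ`, which splits: `M` is a sum
of cyclic groups, and roots of order prime to the characteristic exist in `k`
(`exists_coboundary`). So the `φ m` can be rescaled to be multiplicative, and they glue to an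
isomorphism (`CoxSheaf.nonempty_degIso`, `GradedAlgebraSheaf.DegIso.hom`).
-/

noncomputable section

namespace CoxSheaves

variable {X : Scheme.{u}}

/-! ### Principal divisors -/

theorem eq_mul_of_inv_eq {F : Type*} [Field F] {f g h : Fˣ} {a : F}
    (H : ((g⁻¹ : Fˣ) : F) = h * (a * ((f⁻¹ : Fˣ) : F))) : (f : F) = a * ((g * h : Fˣ) : F) := by
  have hf := f.ne_zero
  have hg := g.ne_zero
  rw [Units.val_inv_eq_inv_val, Units.val_inv_eq_inv_val] at H
  field_simp at H
  rw [Units.val_mul, H]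
  ring

theorem mul_eq_of_mul_inv_eq {F : Type*} [Field F] {f g h : Fˣ} {a : F}
    (H : a * ((g⁻¹ : Fˣ) : F) = h * ((f⁻¹ : Fˣ) : F)) : ((g * h : Fˣ) : F) = a * f := by
  have hf := f.ne_zero
  have hg := g.ne_zero
  rw [Units.val_inv_eq_inv_val, Units.val_inv_eq_inv_val] at H
  field_simp at H
  rw [Units.val_mul, H]

section Divisors

variable [IsIntegral X]

theorem genericPoint_mem {U : X.Opens} {x : X} (hx : x ∈ U) : genericPoint X ∈ U :=
  ((genericPoint_spec X).mem_open_set_iff U.isOpen).2 ⟨x, trivial, hx⟩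

/-- Rational functions dividing each other in the local ring at `x` have the same divisor at `x`. -/
theorem germDiv_eq_of_dvd_dvd {x : X} {f g : X.functionFieldˣ} (a b : X.presheaf.stalk x)
    (ha : (f : X.functionField) = algebraMap (X.presheaf.stalk x) X.functionField a * g)
    (hb : (g : X.functionField) = algebraMap (X.presheaf.stalk x) X.functionField b * f) :
    germDiv X x f = germDiv X x g := by
  have hinj : Function.Injective (algebraMap (X.presheaf.stalk x) X.functionField) :=
    IsFractionRing.injective (X.presheaf.stalk x) X.functionField
  have hab : b * a = 1 := by
    refine hinj ?_
    rw [map_mul, map_one]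
    refine mul_right_cancel₀ (Units.ne_zero g) ?_
    rw [mul_assoc, ← ha, ← hb, one_mul]
  refine QuotientGroup.eq.2 ⟨⟨b, a, hab, by rw [mul_comm, hab]⟩, Units.ext ?_⟩
  change algebraMap (X.presheaf.stalk x) X.functionField b = (f⁻¹ : X.functionFieldˣ) * g
  rw [hb, mul_comm, mul_assoc, Units.mul_inv, mul_one]

theorem mem_range_of_germDiv_eq_one {x : X} {f : X.functionFieldˣ} (h : germDiv X x f = 1) :
    (f : X.functionField) ∈ (algebraMap (X.presheaf.stalk x) X.functionField).range := by
  obtain ⟨u, rfl⟩ := (QuotientGroup.eq_one_iff f).1 h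
  exact ⟨u.1, rfl⟩

namespace CaDiv

/-- The principal Cartier divisor of a nonzero rational function. -/
def principal (h : X.functionFieldˣ) : CaDiv X :=
  ⟨fun x ↦ Additive.ofMul (germDiv X x h), fun _ ↦ ⟨⊤, trivial, h, fun _ _ ↦ rfl⟩⟩

theorem isLocalEquation_principal (h : X.functionFieldˣ) (x : X) :
    (principal h).IsLocalEquation x h := rfl

theorem principal_mul (g h : X.functionFieldˣ) :
    principal (g * h) = principal g + principal h :=
  Subtype.ext (funext fun x ↦ congrArg Additive.ofMul (map_mul (germDiv X x) g h))

/-- An isomorphism `𝒪_X(D) ≅ 𝒪_X(D')` is multiplication by a rational function `h`, and then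
`D` and `D'` differ by the divisor of `h`. -/
theorem exists_mul_of_equiv {D D' : CaDiv X}
    (θ : ∀ U : X.Opens, D.sections U ≃ₗ[Γ(X, U)] D'.sections U)
    (hθ : ∀ {U V : X.Opens} (h : V ≤ U) (s : D.sections U),
      θ V (D.restrict h s) = D'.restrict h (θ U s)) :
    ∃ h : X.functionFieldˣ, (∀ (U : X.Opens) (s : D.sections U) (x : U),
      (θ U s).1 x = h * s.1 x) ∧ D = D' + principal h := by
  obtain ⟨U₀, f₀, hη₀, hf₀⟩ := D.exists_localEquation (genericPoint X)
  let η₀ : U₀ := ⟨genericPoint X, hη₀⟩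
  -- The factor `h` is read off from the image of the generator `f₀⁻¹` near the generic point.
  have hne : (θ U₀ (gen hf₀)).1 η₀ ≠ 0 := by
    intro h0
    have h1 : θ U₀ (gen hf₀) = 0 :=
      Subtype.ext (funext fun x ↦ (sections_const _ x η₀).trans h0)
    have h2 : gen hf₀ = 0 := (θ U₀).injective (h1.trans (map_zero _).symm)
    exact Units.ne_zero (f₀⁻¹) (congrFun (congrArg Subtype.val h2) η₀)
  have key (U : X.Opens) (s : D.sections U) (x : U) :
      (θ U s).1 x = ((θ U₀ (gen hf₀)).1 η₀ * f₀) * s.1 x := by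
    have hη := genericPoint_mem x.2
    let V := U ⊓ U₀
    let η : V := ⟨genericPoint X, hη, hη₀⟩
    obtain ⟨r, hr⟩ := (gen_bijective (D := D) (U := V) fun y hy ↦ hf₀ y hy.2).2
      (D.restrict inf_le_left s)
    have h1 : s.1 x = evalAt η r * ((f₀⁻¹ : X.functionFieldˣ) : X.functionField) :=
      (sections_const s x ⟨genericPoint X, hη⟩).trans
        (congrFun (congrArg Subtype.val hr.symm) η)
    have h2 : (θ U s).1 x = evalAt η r * (θ U₀ (gen hf₀)).1 η₀ := by
      have h3 : θ V (r • D.restrict inf_le_right (gen hf₀)) = D'.restrict inf_le_left (θ U s) :=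
        (congrArg (θ V) hr).trans (hθ _ _)
      rw [map_smul, hθ] at h3
      exact (sections_const _ x ⟨genericPoint X, hη⟩).trans
        (congrFun (congrArg Subtype.val h3.symm) η)
    rw [h1, h2, mul_mul_mul_comm, mul_comm (evalAt η r), mul_assoc, Units.mul_inv, mul_one,
      mul_comm]
  refine ⟨Units.mk0 _ hne * f₀, key, Subtype.ext (funext fun x ↦ ?_)⟩
  generalize hh : Units.mk0 _ hne * f₀ = h
  have key (U : X.Opens) (s : D.sections U) (x : U) : (θ U s).1 x = h * s.1 x := by
    rw [key, ← hh]
    rfl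
  obtain ⟨U, f, hxU, hf⟩ := D.exists_localEquation x
  obtain ⟨U', f', hxU', hf'⟩ := D'.exists_localEquation x
  let V := U ⊓ U'
  let y : V := ⟨x, hxU, hxU'⟩
  -- Both `e` and `θ⁻¹ e'` generate `𝒪_X(D)` near `x`, so they divide each other.
  let e : D.sections V := gen fun y hy ↦ hf y hy.1
  let e' : D'.sections V := gen fun y hy ↦ hf' y hy.2
  obtain ⟨r, hr⟩ := (gen_bijective (D := D') (U := V) fun y hy ↦ hf' y hy.2).2 (θ V e)
  obtain ⟨r', hr'⟩ := (gen_bijective (D := D) (U := V) fun y hy ↦ hf y hy.1).2 ((θ V).symm e')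
  have h1 : evalAt y r * ((f'⁻¹ : X.functionFieldˣ) : X.functionField) =
      h * ((f⁻¹ : X.functionFieldˣ) : X.functionField) :=
    (congrFun (congrArg Subtype.val hr) y).trans (key V e y)
  have h2 : ((f'⁻¹ : X.functionFieldˣ) : X.functionField) =
      h * (evalAt y r' * ((f⁻¹ : X.functionFieldˣ) : X.functionField)) := by
    have := key V ((θ V).symm e') y
    rw [LinearEquiv.apply_symm_apply, ← hr'] at this
    exact this
  change D.1 x = D'.1 x + Additive.ofMul (germDiv X x h)
  rw [hf x hxU, hf' x hxU', ← ofMul_mul, ← map_mul]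
  refine congrArg Additive.ofMul (germDiv_eq_of_dvd_dvd (X.presheaf.germ V x y.2 r')
    (X.presheaf.germ V x y.2 r) ?_ ?_)
  · exact eq_mul_of_inv_eq h2
  · exact mul_eq_of_mul_inv_eq h1

/-- A rational function with trivial divisor is a global unit. -/
theorem exists_unit_of_principal_eq_zero {h : X.functionFieldˣ} (hh : principal h = 0) :
    ∃ a : Γ(X, ⊤)ˣ, ∀ x : (⊤ : X.Opens), evalAt x a.1 = h := by
  have h1 (x : X) : germDiv X x h = 1 :=
    Additive.ofMul.injective (congrFun (congrArg Subtype.val hh) x)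
  have h2 (x : X) : germDiv X x h⁻¹ = 1 := by rw [map_inv, h1, inv_one]
  obtain ⟨r, hr⟩ := exists_evalAt_eq (U := (⊤ : X.Opens)) (fun _ ↦ (h : X.functionField))
    (fun _ _ ↦ rfl) fun x ↦ mem_range_of_germDiv_eq_one (h1 x.1)
  obtain ⟨r', hr'⟩ := exists_evalAt_eq (U := (⊤ : X.Opens))
    (fun _ ↦ ((h⁻¹ : X.functionFieldˣ) : X.functionField))
    (fun _ _ ↦ rfl) fun x ↦ mem_range_of_germDiv_eq_one (h2 x.1)
  have hrr : r * r' = 1 := by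
    refine evalAt_injective (⟨genericPoint X, trivial⟩ : (⊤ : X.Opens)) ?_
    rw [map_mul, hr, hr', map_one, Units.mul_inv]
  exact ⟨⟨r, r', hrr, by rw [mul_comm, hrr]⟩, hr⟩

/-- Divisors with the same class differ by a principal divisor. -/
theorem exists_principal_of_toPic_eq {D D' : CaDiv X} (h : toPic D = toPic D') :
    ∃ g : X.functionFieldˣ, D = D' + principal g := by
  have h1 : D.invertibleSheaf.cls = D'.invertibleSheaf.cls :=
    congrArg (fun a : Additive (Pic X) ↦ a.toMul.1) h
  obtain ⟨i⟩ := Quotient.exact h1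
  let j : toPreMod D.sheaf ≅ toPreMod D'.sheaf := toPreModIso i
  have hinv (U : X.Opens) (s) : homSections j.inv U (homSections j.hom U s) = s := by
    change homSections (j.hom ≫ j.inv) U s = s
    rw [j.hom_inv_id]
    rfl
  have hinv' (U : X.Opens) (s) : homSections j.hom U (homSections j.inv U s) = s := by
    change homSections (j.inv ≫ j.hom) U s = s
    rw [j.inv_hom_id]
    rfl
  obtain ⟨g, -, hg⟩ := exists_mul_of_equiv (D := D) (D' := D')
    (fun U ↦ { homSections j.hom U with
      invFun := homSections j.inv U
      left_inv := hinv U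
      right_inv := hinv' U }) (fun h s ↦ homSec_res j.hom h s)
  exact ⟨g, hg⟩

end CaDiv

end Divisors

/-! ### Every invertible sheaf on an integral scheme is given by a Cartier divisor -/

section Surjective

variable [IsIntegral X]

/-- A generator of a presheaf of modules over a neighbourhood of the generic point. -/
structure GenericGenerator (P : PreMod X) where
  /-- The open set over which the generator is defined. -/
  opens : X.Opens
  mem : genericPoint X ∈ opens
  /-- The generator. -/
  gen : Sections P opens
  bijective : ∀ (V : X.Opens) (h : V ≤ opens),
    Function.Bijective (fun r : Γ(X, V) ↦ r • res P h gen)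

namespace GenericGenerator

variable {P : PreMod X} (e : GenericGenerator P)

/-- The coordinate of a section with respect to a generic generator, a rational function. -/
def coord {U : X.Opens} (hU : genericPoint X ∈ U) : Sections P U →+ X.functionField :=
  (evalAt (⟨genericPoint X, hU, e.mem⟩ : {x // x ∈ U ⊓ e.opens})).toAddMonoidHom.comp
    ((genEquiv _ (e.bijective (U ⊓ e.opens) inf_le_right)).symm.toAddMonoidHom.comp
      (res P inf_le_left))

/-- The coordinate can be computed over any smaller neighbourhood of the generic point. -/
theorem coord_eq {U V : X.Opens} (hU : genericPoint X ∈ U) (s : Sections P U)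
    (hV : genericPoint X ∈ V)
    (h : V ≤ U) (h' : V ≤ e.opens) {r : Γ(X, V)} (hr : res P h s = r • res P h' e.gen) :
    e.coord hU s = evalAt ⟨genericPoint X, hV⟩ r := by
  let r' := (genEquiv _ (e.bijective (U ⊓ e.opens) inf_le_right)).symm (res P inf_le_left s)
  have hr' : r' • res P inf_le_right e.gen = res P inf_le_left s :=
    (genEquiv _ (e.bijective (U ⊓ e.opens) inf_le_right)).apply_symm_apply _
  have h1 : resO (le_inf h h') r' = r := by
    refine (e.bijective V h').1 ?_
    change _ • _ = _ • _
    rw [← hr, ← res_res P inf_le_left (le_inf h h') s, ← hr', res_smul, res_res]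
  rw [← h1, evalAt_resO]
  rfl

theorem exists_eq {U : X.Opens} (hU : genericPoint X ∈ U) (s : Sections P U) :
    ∃ (V : X.Opens) (h : V ≤ U) (h' : V ≤ e.opens) (_ : genericPoint X ∈ V) (r : Γ(X, V)),
      res P h s = r • res P h' e.gen := by
  obtain ⟨r, hr⟩ := (e.bijective (U ⊓ e.opens) inf_le_right).2 (res P inf_le_left s)
  exact ⟨_, inf_le_left, inf_le_right, ⟨hU, e.mem⟩, r, hr.symm⟩

theorem coord_res {U V : X.Opens} (hU : genericPoint X ∈ U) (hV : genericPoint X ∈ V) (h : V ≤ U)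
    (s : Sections P U) : e.coord hV (res P h s) = e.coord hU s := by
  obtain ⟨W, h1, h2, hW, r, hr⟩ := e.exists_eq hV (res P h s)
  rw [e.coord_eq hV _ hW h1 h2 hr, e.coord_eq hU s hW (h1.trans h) h2
    ((res_res P h h1 s).symm.trans hr)]

theorem coord_smul {U : X.Opens} (hU : genericPoint X ∈ U) (a : Γ(X, U)) (s : Sections P U) :
    e.coord hU (a • s) = evalAt ⟨genericPoint X, hU⟩ a * e.coord hU s := by
  obtain ⟨W, h1, h2, hW, r, hr⟩ := e.exists_eq hU s
  rw [e.coord_eq hU s hW h1 h2 hr, e.coord_eq hU (a • s) hW h1 h2 (r := resO h1 a * r)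
    (by rw [res_smul, hr, mul_smul]), map_mul, evalAt_resO]

/-- Local generators have nonzero coordinate. -/
theorem coord_ne_zero {U : X.Opens} (hU : genericPoint X ∈ U) {s : Sections P U}
    (hs : Function.Bijective
      (fun r : Γ(X, U ⊓ e.opens) ↦ r • res P (inf_le_left : U ⊓ e.opens ≤ U) s)) :
    e.coord hU s ≠ 0 := by
  intro h0
  obtain ⟨r, hr⟩ := hs.2 (res P inf_le_right e.gen)
  have hV : genericPoint X ∈ U ⊓ e.opens := ⟨hU, e.mem⟩
  have h1 : e.coord hV (res P inf_le_right e.gen) = 1 := by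
    rw [e.coord_eq hV _ hV le_rfl inf_le_right (r := 1) (by rw [res_res, one_smul]), map_one]
  have h2 : e.coord hV (r • res P inf_le_left s) = 0 := by
    rw [coord_smul, coord_res e hU, h0, mul_zero]
  exact one_ne_zero (h1.symm.trans ((congrArg (e.coord hV) hr.symm).trans h2))

end GenericGenerator

/-- Every invertible sheaf on an integral scheme is isomorphic to `𝒪_X(D)` for some Cartier
divisor `D`: after choice of a generic generator its sections are rational functions, and the
coordinates of local generators are the inverses of local equations of `D`. -/
theorem exists_sheaf_iso (L : X.Modules) (hL : IsInvertible (toPreMod L)) :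
    ∃ D : CaDiv X, Nonempty (L ≅ D.sheaf) := by
  let P := toPreMod L
  obtain ⟨U₀, hη₀, e₀, he₀⟩ := hL (genericPoint X)
  let e : GenericGenerator P := ⟨U₀, hη₀, e₀, he₀⟩
  choose U hxU g hg using hL
  have hη (x : X) : genericPoint X ∈ U x := genericPoint_mem (hxU x)
  let c (x : X) : X.functionFieldˣ :=
    Units.mk0 (e.coord (hη x) (g x)) (e.coord_ne_zero _ (hg x _ _))
  -- Two local generators divide each other at the points where both are defined.
  have hc (x y z : X) (hz : z ∈ U x) (hz' : z ∈ U y) :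
      ∃ a : X.presheaf.stalk z, (c x : X.functionField) =
        algebraMap (X.presheaf.stalk z) X.functionField a * c y := by
    let V := U x ⊓ U y
    obtain ⟨r, hr⟩ := (hg y V inf_le_right).2 (res P inf_le_left (g x))
    refine ⟨X.presheaf.germ V z ⟨hz, hz'⟩ r, ?_⟩
    have hV : genericPoint X ∈ V := ⟨hη x, hη y⟩
    have h1 := congrArg (e.coord hV) hr
    rw [e.coord_smul, e.coord_res (hη y), e.coord_res (hη x)] at h1
    refine h1.symm.trans ?_
    rw [evalAt_eq _ (⟨z, hz, hz'⟩ : {z // z ∈ V})]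
    rfl
  have hcc (x y : X) (hy : y ∈ U x) : germDiv X y (c y)⁻¹ = germDiv X y (c x)⁻¹ := by
    obtain ⟨a, ha⟩ := hc x y y hy (hxU y)
    obtain ⟨b, hb⟩ := hc y x y (hxU y) hy
    rw [map_inv, map_inv, germDiv_eq_of_dvd_dvd a b ha hb]
  let D : CaDiv X := ⟨fun x ↦ Additive.ofMul (germDiv X x (c x)⁻¹), fun x ↦
    ⟨U x, hxU x, (c x)⁻¹, fun y hy ↦ congrArg Additive.ofMul (hcc x y hy)⟩⟩
  have hD (x y : X) (hy : y ∈ U x) : D.IsLocalEquation y (c x)⁻¹ :=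
    congrArg Additive.ofMul (hcc x y hy)
  let φ (V : X.Opens) : Sections P V →ₗ[Γ(X, V)] D.sections V :=
    { toFun s := ⟨fun x ↦ e.coord (genericPoint_mem x.2) s,
        IsLocallyConstant.of_constant _ fun _ _ ↦ rfl, fun x ↦ by
          refine ((hD x.1 x.1 (hxU _)).mul_iff _).2 ?_
          let W := V ⊓ U x.1
          have hW : genericPoint X ∈ W := ⟨genericPoint_mem x.2, hη x.1⟩
          obtain ⟨r, hr⟩ := (hg x.1 W inf_le_right).2 (res P inf_le_left s)
          refine ⟨X.presheaf.germ W x.1 ⟨x.2, hxU x.1⟩ r, ?_⟩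
          have h1 := congrArg (e.coord hW) hr
          rw [e.coord_smul, e.coord_res (hη x.1), e.coord_res (genericPoint_mem x.2),
            evalAt_eq _ (⟨x.1, x.2, hxU x.1⟩ : {z // z ∈ W})] at h1
          exact (Units.eq_mul_inv_iff_mul_eq (c x.1)).2 h1⟩
      map_add' s t := Subtype.ext (funext fun x ↦ map_add (e.coord _) s t)
      map_smul' r s := Subtype.ext (funext fun x ↦
        (e.coord_smul _ r s).trans (congrArg (· * _) (evalAt_eq _ x r))) }
  let Φ : P ⟶ toPreMod D.sheaf := homOfSections φ fun {V W} h s ↦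
    Subtype.ext (funext fun x ↦ e.coord_res _ _ h s)
  have hΦ : IsLocallyBijective Φ := by
    refine IsLocallyBijective.of_generators _ fun x ↦ ⟨U x, hxU x, fun V hV ↦ ?_⟩
    have hE := hg x V hV
    refine (Function.Bijective.of_comp_iff _ hE).1 ?_
    have hgen : ∀ y ∈ V, D.IsLocalEquation y (c x)⁻¹ := fun y hy ↦ hD x y (hV hy)
    suffices homSections Φ V ∘ (fun r : Γ(X, V) ↦ r • res P hV (g x)) =
        fun r ↦ (r • CaDiv.gen hgen : D.sections V) by
      rw [this]
      exact CaDiv.gen_bijective hgen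
    funext r
    refine Subtype.ext (funext fun y ↦ ?_)
    change e.coord _ (r • res P hV (g x)) = evalAt y r * (((c x)⁻¹)⁻¹ : X.functionFieldˣ)
    rw [e.coord_smul, e.coord_res (hη x), inv_inv, evalAt_eq _ y]
    rfl
  obtain ⟨i⟩ := hΦ.nonempty_iso
  exact ⟨D, ⟨(sheafifyToPreMod L).symm ≪≫ i ≪≫ sheafifyToPreMod D.sheaf⟩⟩

theorem CaDiv.toPic_surjective : Function.Surjective (toPic (X := X)) := by
  intro a
  obtain ⟨L, hL⟩ := Quotient.exists_rep a.toMul.1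
  obtain ⟨D, ⟨i⟩⟩ := exists_sheaf_iso L.1 L.2
  refine ⟨D, Additive.toMul.injective (Units.ext ?_)⟩
  exact (InvertibleSheaf.cls_eq (L := L) (L' := D.invertibleSheaf) i).symm.trans hL

end Surjective

/-! ### Extensions of finitely generated abelian groups -/

section Extensions

open DirectSum in
/-- A surjection onto a finitely generated abelian group splits as soon as every torsion element
lifts to an element of the same order. -/
theorem exists_section_of_lift_torsion {E M : Type*} [AddCommGroup E] [AddCommGroup M]
    [AddGroup.FG M] (π : E →+ M) (hπ : Function.Surjective π)
    (htors : ∀ (g : M) (n : ℕ), n ≠ 0 → addOrderOf g = n → ∃ e, π e = g ∧ n • e = 0) :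
    ∃ s : M →+ E, ∀ m, π (s m) = m := by
  classical
  obtain ⟨r, ι, _, p, hp, e, ⟨F⟩⟩ := AddCommGroup.equiv_free_prod_directSum_zmod M
  choose a ha using fun i : Fin r ↦ hπ (F.symm (Finsupp.single i 1, 0))
  let g (i : ι) : M := F.symm (0, DirectSum.of (fun i ↦ ZMod (p i ^ e i)) i 1)
  have hg (i : ι) : (p i ^ e i) • g i = 0 := by
    rw [← map_nsmul, Prod.smul_mk, smul_zero, ← map_nsmul, nsmul_eq_mul, ZMod.natCast_self,
      zero_mul, map_zero]
    exact map_zero F.symm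
  have hb (i : ι) : ∃ b : E, π b = g i ∧ (p i ^ e i) • b = 0 := by
    have hdvd := addOrderOf_dvd_of_nsmul_eq_zero (hg i)
    obtain ⟨b, hb, hb0⟩ := htors (g i) _
      (ne_zero_of_dvd_ne_zero (pow_ne_zero _ (hp i).ne_zero) hdvd) rfl
    obtain ⟨c, hc⟩ := hdvd
    exact ⟨b, hb, by rw [hc, mul_comm, mul_nsmul', hb0, smul_zero]⟩
  choose b hb hb0 using hb
  let s₁ : (Fin r →₀ ℤ) →+ E := Finsupp.liftAddHom fun i ↦ zmultiplesHom E (a i)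
  let s₂ : (⨁ i, ZMod (p i ^ e i)) →+ E := DirectSum.toAddMonoid fun i ↦
    ZMod.lift (p i ^ e i) ⟨zmultiplesHom E (b i), (natCast_zsmul _ _).trans (hb0 i)⟩
  have key₁ : π.comp s₁ = F.symm.toAddMonoidHom.comp (AddMonoidHom.inl _ _) := by
    ext i
    simp [s₁, ha]
  have key₂ : π.comp s₂ = F.symm.toAddMonoidHom.comp (AddMonoidHom.inr _ _) := by
    ext i x
    obtain ⟨z, rfl⟩ := ZMod.intCast_surjective x
    have h1 : (DirectSum.of (fun i ↦ ZMod (p i ^ e i)) i (z : ZMod (p i ^ e i))) =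
        z • DirectSum.of (fun i ↦ ZMod (p i ^ e i)) i 1 := by
      rw [← map_zsmul, zsmul_one]
    have h2 : F.symm (0, z • DirectSum.of (fun i ↦ ZMod (p i ^ e i)) i 1) = z • g i := by
      refine Eq.trans ?_ (map_zsmul F.symm z _)
      rw [Prod.smul_mk, smul_zero]
    have h3 : s₂ (DirectSum.of (fun i ↦ ZMod (p i ^ e i)) i (z : ZMod (p i ^ e i))) = z • b i := by
      rw [DirectSum.toAddMonoid_of, ZMod.lift_coe]
      rfl
    change π (s₂ _) = F.symm (0, _)
    rw [h3, h1, h2, map_zsmul, hb]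
  have key (x) : π (s₁.coprod s₂ x) = F.symm x := by
    rw [AddMonoidHom.coprod_apply, map_add]
    refine (congrArg₂ (· + ·) (DFunLike.congr_fun key₁ x.1) (DFunLike.congr_fun key₂ x.2)).trans ?_
    refine (map_add F.symm _ _).symm.trans (congrArg F.symm ?_)
    simp
  exact ⟨(s₁.coprod s₂).comp F.toAddMonoidHom, fun m ↦ (key (F m)).trans (F.symm_apply_apply m)⟩

/-- The extension of an abelian group `M` by `C` defined by a symmetric `2`-cocycle: pairs with
`(c, m) + (d, n) = (c + d + α m n, m + n)`. -/
@[ext]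
structure CocycleExtension {M C : Type*} (α : M → M → C) where
  /-- The coordinate in the kernel. -/
  fst : C
  /-- The coordinate in the quotient. -/
  snd : M

namespace CocycleExtension

variable {M C : Type*} [AddCommGroup M] [AddCommGroup C] {α : M → M → C}

/-- The group structure on the extension. The neutral element is `(-α 0 0, 0)`, as `α` need not be
normalised. -/
@[reducible]
def addCommGroup (hcomm : ∀ m n, α m n = α n m)
    (hassoc : ∀ m n l, α m n + α (m + n) l = α n l + α m (n + l)) :
    AddCommGroup (CocycleExtension α) :=
  have h0 (l : M) : α 0 l = α 0 0 := by
    have := hassoc 0 0 l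
    rw [add_zero, zero_add, add_right_cancel_iff] at this
    exact this.symm
  letI : Add (CocycleExtension α) := ⟨fun x y ↦ ⟨x.fst + y.fst + α x.snd y.snd, x.snd + y.snd⟩⟩
  letI : Zero (CocycleExtension α) := ⟨⟨-α 0 0, 0⟩⟩
  letI : Neg (CocycleExtension α) := ⟨fun x ↦ ⟨-x.fst - α (-x.snd) x.snd - α 0 0, -x.snd⟩⟩
  have hz (x : CocycleExtension α) : 0 + x = x := by
    refine CocycleExtension.ext ?_ (zero_add _)
    change -α 0 0 + x.fst + α 0 x.snd = _
    rw [h0 x.snd]; abel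
  have hc (x y : CocycleExtension α) : x + y = y + x := by
    refine CocycleExtension.ext ?_ (add_comm _ _)
    change _ + _ + α _ _ = _ + _ + α _ _
    rw [hcomm, add_comm x.fst]
  { add_assoc x y z := by
      refine CocycleExtension.ext ?_ (add_assoc _ _ _)
      change (x.fst + y.fst + α x.snd y.snd) + z.fst + α (x.snd + y.snd) z.snd =
        x.fst + (y.fst + z.fst + α y.snd z.snd) + α x.snd (y.snd + z.snd)
      have := hassoc x.snd y.snd z.snd
      rw [← sub_eq_zero] at this ⊢
      rw [← this]; abel
    zero_add := hz
    add_zero x := (hc x 0).trans (hz x)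
    add_comm := hc
    neg_add_cancel x := by
      refine CocycleExtension.ext ?_ (neg_add_cancel _)
      change (-x.fst - α (-x.snd) x.snd - α 0 0) + x.fst + α (-x.snd) x.snd = -α 0 0
      abel
    nsmul := nsmulRec
    zsmul := zsmulRec }

end CocycleExtension

/-- A symmetric `2`-cocycle on a finitely generated abelian group is a coboundary if its values
are divisible by the orders of the torsion elements. -/
theorem exists_coboundary {M C : Type*} [AddCommGroup M] [AddGroup.FG M] [AddCommGroup C]
    (hdiv : ∀ (g : M) (n : ℕ), n ≠ 0 → addOrderOf g = n → ∀ c : C, ∃ d, n • d = c)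
    (α : M → M → C) (hcomm : ∀ m n, α m n = α n m)
    (hassoc : ∀ m n l, α m n + α (m + n) l = α n l + α m (n + l)) :
    ∃ β : M → C, ∀ m n, β m + β n + α m n = β (m + n) := by
  let _ := CocycleExtension.addCommGroup hcomm hassoc
  let π : CocycleExtension α →+ M := AddMonoidHom.mk' (fun x ↦ x.snd) fun _ _ ↦ rfl
  -- The shift by `α 0 0` makes the inclusion of `C` additive.
  let ι : C →+ CocycleExtension α := AddMonoidHom.mk' (fun c ↦ ⟨c - α 0 0, 0⟩) fun c d ↦ by
    refine CocycleExtension.ext ?_ (add_zero (0 : M)).symm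
    change c + d - α 0 0 = (c - α 0 0) + (d - α 0 0) + α 0 0
    abel
  obtain ⟨s, hs⟩ := exists_section_of_lift_torsion π (fun m ↦ ⟨⟨0, m⟩, rfl⟩) fun g n hn hg ↦ by
    let e : CocycleExtension α := ⟨0, g⟩
    have h0 : π (n • e) = 0 := by
      rw [map_nsmul]
      exact addOrderOf_dvd_iff_nsmul_eq_zero.1 (dvd_of_eq hg)
    -- A lift `e` of `g` has `n • e` in `C`; subtracting an `n`-th part of it corrects the order.
    obtain ⟨d, hd⟩ := hdiv g n hn hg ((n • e).fst + α 0 0)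
    refine ⟨e - ι d, ?_, ?_⟩
    · rw [map_sub]
      exact sub_zero g
    · rw [nsmul_sub, ← map_nsmul, hd, sub_eq_zero]
      exact CocycleExtension.ext (add_sub_cancel_right _ _).symm h0
  refine ⟨fun m ↦ (s m).fst, fun m n ↦ ?_⟩
  refine Eq.trans ?_ (congrArg CocycleExtension.fst (map_add s m n)).symm
  change _ = (s m).fst + (s n).fst + α (π (s m)) (π (s n))
  rw [hs, hs]

end Extensions

/-! ### A character up to constants -/

section Character

/-- Maps into a divisible group which are additive up to a subgroup `C` extend from subgroups, as
the quotient by `C` is divisible as well. -/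
theorem exists_extension_of_divisible {A B : Type*} [AddCommGroup A] [AddCommGroup B]
    (hdiv : ∀ n : ℕ, n ≠ 0 → Function.Surjective (fun b : B ↦ n • b)) (C : AddSubgroup B)
    (H : AddSubgroup A) (φ : H → B) (hφ : ∀ p q, -φ (p + q) + (φ p + φ q) ∈ C) :
    ∃ ψ : A → B, (∀ p q, -ψ (p + q) + (ψ p + ψ q) ∈ C) ∧ ∀ p : H, -φ p + ψ p ∈ C := by
  let _ : DivisibleBy (B ⧸ C) ℕ := divisibleByOfSMulRightSurj _ _ fun {n} hn a ↦ by
    obtain ⟨b, rfl⟩ := QuotientAddGroup.mk_surjective a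
    obtain ⟨b', rfl⟩ := hdiv n hn b
    exact ⟨QuotientAddGroup.mk b', rfl⟩
  let _ : DivisibleBy (B ⧸ C) ℤ := AddGroup.divisibleByIntOfDivisibleByNat _
  obtain ⟨ψ, hψ⟩ := (Module.Baer.of_divisible (B ⧸ C)).extension_property_addMonoidHom
    H.subtype H.subtype_injective (AddMonoidHom.mk' (fun p ↦ (QuotientAddGroup.mk (φ p) : B ⧸ C))
      fun p q ↦ QuotientAddGroup.eq.2 (hφ p q))
  have hval (p : A) : (QuotientAddGroup.mk (Quotient.out (ψ p)) : B ⧸ C) = ψ p :=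
    Quotient.out_eq' _
  refine ⟨fun p ↦ Quotient.out (ψ p), fun p q ↦ QuotientAddGroup.eq.1 ?_,
    fun p ↦ QuotientAddGroup.eq.1 ?_⟩
  · rw [QuotientAddGroup.mk_add, hval, hval, hval, map_add]
  · rw [hval]
    exact (DFunLike.congr_fun hψ p).symm

variable {k : Type u} [Field k] [IsIntegral X] {M : Type u} [AddCommGroup M]

/-- The map from the ground field to the function field. -/
def constK (f : X ⟶ Spec (CommRingCat.of k)) : k →+* X.functionField :=
  (evalAt (⟨genericPoint X, trivial⟩ : (⊤ : X.Opens))).comp (constants f ⊤)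

theorem evalAt_constants (f : X ⟶ Spec (CommRingCat.of k)) {U : X.Opens} (x : U) (a : k) :
    evalAt x (constants f U a) = constK f a := by
  have h : constants f U a = resO le_top (constants f ⊤ a) := (resO_resO _ _ _).symm
  rw [h, evalAt_resO]
  exact evalAt_eq _ _ _

/-- A rational function with trivial divisor is constant if all global units are. -/
theorem exists_const_of_principal_eq {f : X ⟶ Spec (CommRingCat.of k)}
    (hX : ∀ a : Γ(X, ⊤)ˣ, ∃ c : k, constants f ⊤ c = a) {g g' : X.functionFieldˣ}
    (h : CaDiv.principal g = CaDiv.principal g') :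
    ∃ α : kˣ, g = Units.map (constK f : k →* X.functionField) α * g' := by
  have h1 : CaDiv.principal (g * g'⁻¹) = 0 := by
    rw [← add_left_inj (CaDiv.principal g'), ← CaDiv.principal_mul, inv_mul_cancel_right, h,
      zero_add]
  obtain ⟨a, ha⟩ := CaDiv.exists_unit_of_principal_eq_zero h1
  obtain ⟨c, hc⟩ := hX a
  have h2 : constK f c = (g * g'⁻¹ : X.functionFieldˣ) := by
    rw [← ha ⟨genericPoint X, trivial⟩, ← hc]
    rfl
  have hc0 : c ≠ 0 := by
    rintro rfl
    exact (g * g'⁻¹).ne_zero (h2.symm.trans (map_zero _))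
  refine ⟨Units.mk0 c hc0, ?_⟩
  rw [← mul_inv_eq_iff_eq_mul]
  exact Units.ext h2.symm

/-- The map from the ground field to the algebraic closure of the function field. -/
def constL (f : X ⟶ Spec (CommRingCat.of k)) : k →+* AlgebraicClosure X.functionField :=
  (algebraMap X.functionField _).comp (constK f)

/-- Nonzero elements `c (m, D)` of the algebraic closure of the function field which up to
constants depend additively on `(m, D)`, and where adding the divisor of `g` to `D` divides
`c (m, D)` by `g`. -/
structure CoxCharacter (f : X ⟶ Spec (CommRingCat.of k)) (lam : M →+ Additive (Pic X)) where
  /-- The values of the character. -/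
  val : gradedDiv lam → (AlgebraicClosure X.functionField)ˣ
  mul : ∀ p q, ∃ α : kˣ, val p * val q = Units.map (constL f : k →* _) α * val (p + q)
  principal : ∀ (p q : gradedDiv lam) (g : X.functionFieldˣ), p.1.1 = q.1.1 →
    q.1.2 = p.1.2 + CaDiv.principal g → ∃ α : kˣ,
      val q * Units.map (algebraMap X.functionField (AlgebraicClosure X.functionField) :
        X.functionField →* _) g = Units.map (constL f : k →* _) α * val p

/-- The character exists since `(0, div g) ↦ g⁻¹` extends to all pairs, the multiplicative group of
an algebraically closed field modulo `kˣ` being divisible. -/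
theorem nonempty_coxCharacter (f : X ⟶ Spec (CommRingCat.of k))
    (hX : ∀ a : Γ(X, ⊤)ˣ, ∃ c : k, constants f ⊤ c = a) (lam : M →+ Additive (Pic X)) :
    Nonempty (CoxCharacter f lam) := by
  let L := AlgebraicClosure X.functionField
  let C : AddSubgroup (Additive Lˣ) := (Units.map (constL f : k →* L)).toAdditive.range
  let j : X.functionFieldˣ →* Lˣ := Units.map (algebraMap X.functionField L : X.functionField →* L)
  -- The pairs in degree `0`; their divisors are principal.
  let H : AddSubgroup (gradedDiv lam) :=
    ((AddMonoidHom.fst M (CaDiv X)).comp (gradedDiv lam).subtype).ker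
  have hH (p : H) : ∃ g : X.functionFieldˣ, p.1.1.2 = CaDiv.principal g := by
    have h1 : CaDiv.toPic p.1.1.2 = CaDiv.toPic (0 : CaDiv X) := by
      have h2 : CaDiv.toPic p.1.1.2 = lam p.1.1.1 := p.1.2
      have h3 : p.1.1.1 = 0 := p.2
      rw [h2, h3, map_zero, map_zero]
    obtain ⟨g, hg⟩ := CaDiv.exists_principal_of_toPic_eq h1
    exact ⟨g, hg.trans (zero_add _)⟩
  have hconst {g g' : X.functionFieldˣ} (h : CaDiv.principal g = CaDiv.principal g') :
      ∃ α : kˣ, j g = Units.map (constL f : k →* L) α * j g' := by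
    obtain ⟨α, rfl⟩ := exists_const_of_principal_eq hX h
    exact ⟨α, map_mul j _ _⟩
  choose g hg using hH
  have hdiv (n : ℕ) (hn : n ≠ 0) : Function.Surjective (fun b : Additive Lˣ ↦ n • b) := by
    intro y
    obtain ⟨z, hz⟩ := IsAlgClosed.exists_pow_nat_eq (y.toMul : L) (Nat.pos_of_ne_zero hn)
    have hz0 : z ≠ 0 := by
      rintro rfl
      exact y.toMul.ne_zero (by rw [← hz, zero_pow hn])
    exact ⟨Additive.ofMul (Units.mk0 z hz0), Additive.toMul.injective (Units.ext hz)⟩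
  obtain ⟨ψ, hψ, hψH⟩ := exists_extension_of_divisible hdiv C H
    (fun p ↦ Additive.ofMul (j (g p))⁻¹) fun p q ↦ by
      obtain ⟨α, hα⟩ := hconst (g := g (p + q)) (g' := g p * g q) <| by
        rw [CaDiv.principal_mul, ← hg, ← hg, ← hg]
        rfl
      refine ⟨Additive.ofMul α, Additive.toMul.injective ?_⟩
      change Units.map (constL f : k →* L) α = ((j (g (p + q)))⁻¹)⁻¹ * ((j (g p))⁻¹ * (j (g q))⁻¹)
      rw [inv_inv, hα, map_mul, ← mul_inv, mul_inv_cancel_right]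
  have hmul (p q) : ∃ α : kˣ, (ψ p).toMul * (ψ q).toMul =
      Units.map (constL f : k →* L) α * (ψ (p + q)).toMul := by
    obtain ⟨α, hα⟩ := hψ p q
    have h : Units.map (constL f : k →* L) α.toMul =
      (ψ (p + q)).toMul⁻¹ * ((ψ p).toMul * (ψ q).toMul) := congrArg Additive.toMul hα
    exact ⟨α.toMul, by rw [h, mul_comm _ (ψ (p + q)).toMul, mul_inv_cancel_left]⟩
  refine ⟨⟨fun p ↦ (ψ p).toMul, hmul, fun p q a h1 h2 ↦ ?_⟩⟩
  have hmem : q - p ∈ H := by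
    change q.1.1 - p.1.1 = 0
    rw [h1, sub_self]
  obtain ⟨α, hα⟩ := hconst (g := a) (g' := g ⟨q - p, hmem⟩) <| by
    rw [← hg]
    exact (sub_eq_of_eq_add' h2).symm
  obtain ⟨β, hβ⟩ := hψH ⟨q - p, hmem⟩
  obtain ⟨γ, hγ⟩ := hmul (q - p) p
  have h : Units.map (constL f : k →* L) β.toMul =
      ((j (g ⟨q - p, hmem⟩))⁻¹)⁻¹ * (ψ (q - p)).toMul := congrArg Additive.toMul hβ
  rw [inv_inv] at h
  rw [sub_add_cancel, ← inv_mul_eq_iff_eq_mul] at hγ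
  refine ⟨γ⁻¹ * α * β.toMul, ?_⟩
  rw [← hγ, map_mul, map_mul, h, map_inv]
  change _ * j a = _
  rw [hα]
  ac_rfl

end Character

/-! ### Construction of a Cox sheaf -/

section Existence

variable {k : Type u} [Field k] [IsIntegral X] {M : Type u} [AddCommGroup M]

/-- Every degree occurs in a pair `(m, D)`. -/
theorem exists_gradedDiv (lam : M →+ Additive (Pic X)) (m : M) :
    ∃ D : CaDiv X, ((m, D) : M × CaDiv X) ∈ gradedDiv lam :=
  CaDiv.toPic_surjective (lam m)

/-- The map from a local ring to the algebraic closure of the function field. -/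
def stalkToL (x : X) : X.presheaf.stalk x →+* AlgebraicClosure X.functionField :=
  (algebraMap X.functionField (AlgebraicClosure X.functionField)).comp
    (algebraMap (X.presheaf.stalk x) X.functionField)

theorem algebraMap_mem_range_stalkToL {x : X} {a : X.functionField} :
    algebraMap X.functionField (AlgebraicClosure X.functionField) a ∈ (stalkToL x).range ↔
      a ∈ (algebraMap (X.presheaf.stalk x) X.functionField).range := by
  constructor
  · rintro ⟨b, hb⟩
    exact ⟨b, (algebraMap X.functionField (AlgebraicClosure X.functionField)).injective hb⟩
  · rintro ⟨b, rfl⟩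
    exact ⟨b, rfl⟩

theorem constL_mem_range_stalkToL (f : X ⟶ Spec (CommRingCat.of k)) (x : X) (a : k) :
    constL f a ∈ (stalkToL x).range := by
  refine algebraMap_mem_range_stalkToL.2 ?_
  rw [← evalAt_constants f (⟨x, trivial⟩ : (⊤ : X.Opens))]
  exact ⟨_, rfl⟩

namespace CoxCharacter

variable {f : X ⟶ Spec (CommRingCat.of k)} {lam : M →+ Additive (Pic X)} (c : CoxCharacter f lam)

/-- The elements of the algebraic closure of the function field whose product with `c (m, D)` is, at
`x`, a germ of `𝒪_X(D)`. -/
def stalkDeg (x : X) (m : M) : AddSubgroup (AlgebraicClosure X.functionField) where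
  carrier := {a | ∀ p : gradedDiv lam, p.1.1 = m → ∀ g : X.functionFieldˣ,
    p.1.2.IsLocalEquation x g →
      a * c.val p * algebraMap X.functionField (AlgebraicClosure X.functionField) g ∈
        (stalkToL x).range}
  zero_mem' p _ g _ := by
    rw [zero_mul, zero_mul]
    exact zero_mem _
  add_mem' {a b} ha hb p hp g hg := by
    rw [add_mul, add_mul]
    exact add_mem (ha p hp g hg) (hb p hp g hg)
  neg_mem' {a} ha p hp g hg := by
    rw [neg_mul, neg_mul]
    exact neg_mem (ha p hp g hg)

/-- Membership in `stalkDeg` can be tested with one divisor and one local equation. -/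
theorem mem_stalkDeg_iff {x : X} (p : gradedDiv lam) {g : X.functionFieldˣ}
    (hg : p.1.2.IsLocalEquation x g) (a : AlgebraicClosure X.functionField) :
    a ∈ c.stalkDeg x p.1.1 ↔
      a * c.val p * algebraMap X.functionField (AlgebraicClosure X.functionField) g ∈
        (stalkToL x).range := by
  refine ⟨fun h ↦ h p rfl g hg, fun h q hq g' hg' ↦ ?_⟩
  have h1 : CaDiv.toPic q.1.2 = CaDiv.toPic p.1.2 := by
    have hp2 : CaDiv.toPic p.1.2 = lam p.1.1 := p.2
    have hq2 : CaDiv.toPic q.1.2 = lam q.1.1 := q.2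
    rw [hp2, hq2, hq]
  obtain ⟨d, hd⟩ := CaDiv.exists_principal_of_toPic_eq h1
  obtain ⟨α, hα⟩ := c.principal p q d hq.symm hd
  have h2 : germDiv X x (g * d) = germDiv X x g' := by
    have h3 := hg.add (CaDiv.isLocalEquation_principal d x)
    rw [← hd] at h3
    exact Additive.ofMul.injective (h3.symm.trans hg')
  obtain ⟨v, hv⟩ := QuotientGroup.eq.1 h2
  have h4 : g' = g * d *
      Units.map (algebraMap (X.presheaf.stalk x) X.functionField).toMonoidHom v := by
    rw [hv, mul_inv_cancel_left]
  have h5 := congrArg Units.val hα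
  have h6 : a * c.val q * algebraMap X.functionField (AlgebraicClosure X.functionField) g' =
      a * c.val p * algebraMap X.functionField (AlgebraicClosure X.functionField) g *
        (constL f α * stalkToL x v) := by
    have h7 : algebraMap X.functionField (AlgebraicClosure X.functionField) g' =
        algebraMap X.functionField (AlgebraicClosure X.functionField) g *
        algebraMap X.functionField (AlgebraicClosure X.functionField) d * stalkToL x v := by
      rw [h4]
      exact (map_mul _ _ _).trans (congrArg (· * _) (map_mul _ _ _))
    have h8 : (c.val q : AlgebraicClosure X.functionField) *
      algebraMap X.functionField (AlgebraicClosure X.functionField) d =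
        constL f α * c.val p := h5
    rw [h7]
    linear_combination (a * algebraMap X.functionField (AlgebraicClosure X.functionField) g *
      stalkToL x v) * h8
  rw [h6]
  exact mul_mem h (mul_mem (constL_mem_range_stalkToL f x α) ⟨v, rfl⟩)

theorem mul_mem_stalkDeg {x : X} {m n : M} {a b : AlgebraicClosure X.functionField}
    (ha : a ∈ c.stalkDeg x m) (hb : b ∈ c.stalkDeg x n) : a * b ∈ c.stalkDeg x (m + n) := by
  obtain ⟨D, hD⟩ := exists_gradedDiv lam m
  obtain ⟨D', hD'⟩ := exists_gradedDiv lam n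
  obtain ⟨V, g, hx, hg⟩ := D.exists_localEquation x
  obtain ⟨V', g', hx', hg'⟩ := D'.exists_localEquation x
  let p : gradedDiv lam := ⟨(m, D), hD⟩
  let q : gradedDiv lam := ⟨(n, D'), hD'⟩
  have h := mul_mem (ha p rfl g (hg x hx)) (hb q rfl g' (hg' x hx'))
  obtain ⟨α, hα⟩ := c.mul p q
  refine (c.mem_stalkDeg_iff (p + q) ((hg x hx).add (hg' x hx')) _).2 ?_
  have h1 : (c.val p * c.val q : AlgebraicClosure X.functionField) =
    constL f α * c.val (p + q) := congrArg Units.val hα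
  have h2 : constL f ((α⁻¹ : kˣ) : k) * constL f α = 1 := by
    rw [← map_mul, Units.inv_mul, map_one]
  convert mul_mem (constL_mem_range_stalkToL f x ((α⁻¹ : kˣ) : k)) h using 1
  have h3 : algebraMap X.functionField (AlgebraicClosure X.functionField)
      (g * g' : X.functionFieldˣ) = algebraMap X.functionField (AlgebraicClosure X.functionField) g *
      algebraMap X.functionField (AlgebraicClosure X.functionField) g' := map_mul _ _ _
  rw [h3]
  linear_combination (-(a * b * algebraMap X.functionField (AlgebraicClosure X.functionField) g *
    algebraMap X.functionField (AlgebraicClosure X.functionField) g' * c.val (p + q))) * h2 -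
    (a * b * algebraMap X.functionField (AlgebraicClosure X.functionField) g *
    algebraMap X.functionField (AlgebraicClosure X.functionField) g' *
      constL f ((α⁻¹ : kˣ) : k)) * h1

theorem one_mem_stalkDeg (x : X) : 1 ∈ c.stalkDeg x 0 := by
  refine (c.mem_stalkDeg_iff 0 (g := 1) rfl 1).2 ?_
  obtain ⟨α, hα⟩ := c.mul 0 0
  rw [add_zero, mul_left_inj] at hα
  have h1 : (c.val 0 : AlgebraicClosure X.functionField) = constL f α := congrArg Units.val hα
  have h2 : algebraMap X.functionField (AlgebraicClosure X.functionField)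
    (1 : X.functionFieldˣ) = 1 := map_one _
  rw [one_mul, h1, h2, mul_one]
  exact constL_mem_range_stalkToL f x α

theorem smul_mem_stalkDeg {x : X} {m : M} {a b : AlgebraicClosure X.functionField}
    (ha : a ∈ (stalkToL x).range) (hb : b ∈ c.stalkDeg x m) : a * b ∈ c.stalkDeg x m := by
  intro p hp g hg
  rw [mul_assoc, mul_assoc, ← mul_assoc b]
  exact mul_mem ha (hb p hp g hg)

/-- The stalk at `x` of the Cox sheaf, as a subring of the group algebra of `M`. -/
def stalkRing (x : X) : Subring (AddMonoidAlgebra (AlgebraicClosure X.functionField) M) where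
  carrier := {a | ∀ m, a.coeff m ∈ c.stalkDeg x m}
  zero_mem' m := zero_mem _
  add_mem' ha hb m := add_mem (ha m) (hb m)
  neg_mem' ha m := neg_mem (ha m)
  one_mem' m := by
    classical
    rw [AddMonoidAlgebra.one_def, AddMonoidAlgebra.coeff_single, Finsupp.single_apply]
    split_ifs with h
    · exact h ▸ c.one_mem_stalkDeg x
    · exact zero_mem _
  mul_mem' {a b} ha hb m := by
    classical
    rw [AddMonoidAlgebra.coeff_mul]
    refine sum_mem fun i _ ↦ sum_mem fun j _ ↦ ?_
    dsimp only
    split_ifs with h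
    · exact h ▸ c.mul_mem_stalkDeg (ha i) (hb j)
    · exact zero_mem _

theorem single_mem_stalkRing {x : X} {m : M} {a : AlgebraicClosure X.functionField}
    (ha : a ∈ c.stalkDeg x m) : AddMonoidAlgebra.single m a ∈ c.stalkRing x := by
  classical
  intro n
  rw [AddMonoidAlgebra.coeff_single, Finsupp.single_apply]
  split_ifs with h
  · exact h ▸ ha
  · exact zero_mem _

/-- The sections of the Cox sheaf over `U`: locally constant functions to the group algebra of `M`
with values in the stalks. -/
def sectionRing (U : X.Opens) :
    Subring (U → AddMonoidAlgebra (AlgebraicClosure X.functionField) M) where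
  carrier := {s | IsLocallyConstant s ∧ ∀ x : U, s x ∈ c.stalkRing x.1}
  zero_mem' := ⟨IsLocallyConstant.const 0, fun _ ↦ zero_mem _⟩
  one_mem' := ⟨IsLocallyConstant.const 1, fun _ ↦ one_mem _⟩
  add_mem' hs ht := ⟨hs.1.add ht.1, fun x ↦ add_mem (hs.2 x) (ht.2 x)⟩
  neg_mem' hs := ⟨hs.1.neg, fun x ↦ neg_mem (hs.2 x)⟩
  mul_mem' hs ht := ⟨hs.1.mul ht.1, fun x ↦ mul_mem (hs.2 x) (ht.2 x)⟩

theorem sectionRing_const {U : X.Opens} (s : c.sectionRing U) (x y : U) : s.1 x = s.1 y := by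
  have : PreconnectedSpace {x // x ∈ U} := Subtype.preconnectedSpace
    ((PreirreducibleSpace.isPreirreducible_univ (X := X)).open_subset U.isOpen
      (Set.subset_univ _)).isPreconnected
  exact s.2.1.apply_eq_of_preconnectedSpace x y

/-- Restriction of sections of the Cox sheaf. -/
def restrict {U V : X.Opens} (h : V ≤ U) : c.sectionRing U →+* c.sectionRing V where
  toFun s := ⟨fun x ↦ s.1 ⟨x.1, h x.2⟩,
    s.2.1.comp_continuous (continuous_inclusion h), fun x ↦ s.2.2 ⟨x.1, h x.2⟩⟩
  map_zero' := rfl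
  map_one' := rfl
  map_add' _ _ := rfl
  map_mul' _ _ := rfl

/-- Membership in `sectionRing` is a local condition. -/
def localPredicate : TopCat.LocalPredicate (X := X)
    (fun _ ↦ (AddMonoidAlgebra (AlgebraicClosure X.functionField) M : Type u)) where
  pred {U} s := s ∈ c.sectionRing U
  res {U V} i s hs := (c.restrict i.le ⟨s, hs⟩).2
  locality {U} s hs := by
    refine ⟨?_, fun x ↦ ?_⟩
    · refine (IsLocallyConstant.iff_eventually_eq s).2 fun x ↦ ?_
      obtain ⟨V, hxV, i, hV⟩ := hs x
      have h1 := (IsLocallyConstant.iff_eventually_eq _).1 hV.1 ⟨x.1, hxV⟩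
      have hemb : Topology.IsOpenEmbedding (Set.inclusion i.le) :=
        Opens.isOpenEmbedding_of_le i.le
      exact (hemb.map_nhds_eq ⟨x.1, hxV⟩) ▸ (Filter.eventually_map.2 h1)
    · obtain ⟨V, hxV, i, hV⟩ := hs x
      exact hV.2 ⟨x.1, hxV⟩

/-- The ring homomorphism from regular functions to sections of the Cox sheaf, with image in
degree `0`. -/
def structureMap (U : X.Opens) : Γ(X, U) →+* c.sectionRing U where
  toFun r := ⟨fun x ↦
      AddMonoidAlgebra.singleZeroRingHom (algebraMap X.functionField _ (evalAt x r)),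
    IsLocallyConstant.of_constant _ fun x y ↦ by rw [evalAt_eq x y], fun x ↦
      c.single_mem_stalkRing (mul_one (algebraMap X.functionField
        (AlgebraicClosure X.functionField) (evalAt x r)) ▸
          c.smul_mem_stalkDeg ⟨X.presheaf.germ U x.1 x.2 r, rfl⟩ (c.one_mem_stalkDeg x.1))⟩
  map_zero' := Subtype.ext (funext fun x ↦ by simp only [map_zero]; rfl)
  map_one' := Subtype.ext (funext fun x ↦ by simp only [map_one]; rfl)
  map_add' r s := Subtype.ext (funext fun x ↦ by simp only [map_add]; rfl)
  map_mul' r s := Subtype.ext (funext fun x ↦ by simp only [map_mul]; rfl)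

/-- The underlying sheaf of algebras of the Cox sheaf. -/
def algebraSheaf : AlgebraSheaf X where
  presheaf :=
    { obj U := CommRingCat.of (c.sectionRing U.unop)
      map i := CommRingCat.ofHom (c.restrict i.unop.le) }
  isSheaf := (TopCat.Presheaf.isSheaf_iff_isSheaf_comp (forget CommRingCat) _).2
    (TopCat.subpresheafToTypes.isSheaf c.localPredicate)
  structureHom :=
    { app U := CommRingCat.ofHom (c.structureMap U.unop)
      naturality U V i := CommRingCat.hom_ext (RingHom.ext fun r ↦ Subtype.ext (funext fun x ↦
        congrArg (fun a ↦ AddMonoidAlgebra.singleZeroRingHom (algebraMap X.functionField _ a))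
          (evalAt_resO i.unop.le x r))) }

/-- A section of the Cox sheaf as a function. -/
def fn {U : X.Opens} (s : c.algebraSheaf.sections U) (x : U) :
    AddMonoidAlgebra (AlgebraicClosure X.functionField) M :=
  (show c.sectionRing U from s).1 x

/-- A section of the Cox sheaf from a function. -/
def ofFn {U : X.Opens} (s : U → AddMonoidAlgebra (AlgebraicClosure X.functionField) M)
    (hs : ∀ x y, s x = s y) (hs' : ∀ x : U, s x ∈ c.stalkRing x.1) : c.algebraSheaf.sections U :=
  show c.sectionRing U from ⟨s, IsLocallyConstant.of_constant _ hs, hs'⟩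

theorem fn_ext {U : X.Opens} {s t : c.algebraSheaf.sections U} (h : ∀ x, c.fn s x = c.fn t x) :
    s = t :=
  Subtype.ext (funext h)

theorem fn_const {U : X.Opens} (s : c.algebraSheaf.sections U) (x y : U) : c.fn s x = c.fn s y :=
  c.sectionRing_const s x y

theorem fn_mem {U : X.Opens} (s : c.algebraSheaf.sections U) (x : U) :
    c.fn s x ∈ c.stalkRing x.1 :=
  (show c.sectionRing U from s).2.2 x

theorem fn_add {U : X.Opens} (s t : c.algebraSheaf.sections U) (x : U) :
    c.fn (s + t) x = c.fn s x + c.fn t x := rfl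

theorem fn_mul {U : X.Opens} (s t : c.algebraSheaf.sections U) (x : U) :
    c.fn (s * t) x = c.fn s x * c.fn t x := rfl

theorem fn_smul {U : X.Opens} (r : Γ(X, U)) (s : c.algebraSheaf.sections U) (x : U) :
    c.fn (r • s) x = AddMonoidAlgebra.single 0 (algebraMap X.functionField _ (evalAt x r)) *
      c.fn s x := rfl

theorem fn_ofFn {U : X.Opens} (s : U → AddMonoidAlgebra (AlgebraicClosure X.functionField) M)
    (hs : ∀ x y, s x = s y) (hs' : ∀ x : U, s x ∈ c.stalkRing x.1) (x : U) :
    c.fn (c.ofFn s hs hs') x = s x := rfl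

/-- The degree-`m`-part: the sections with values in degree `m` of the group algebra. -/
def deg (U : X.Opens) (m : M) : Submodule Γ(X, U) (c.algebraSheaf.sections U) where
  carrier := {s | ∀ x, ∃ a, c.fn s x = AddMonoidAlgebra.single m a}
  zero_mem' x := ⟨0, (AddMonoidAlgebra.single_zero m).symm⟩
  add_mem' {s t} hs ht x := by
    obtain ⟨a, ha⟩ := hs x
    obtain ⟨b, hb⟩ := ht x
    exact ⟨a + b, by rw [fn_add, ha, hb, AddMonoidAlgebra.single_add]⟩
  smul_mem' r s hs x := by
    obtain ⟨a, ha⟩ := hs x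
    exact ⟨_, by rw [fn_smul, ha, AddMonoidAlgebra.single_mul_single, zero_add]⟩

theorem fn_deg {U : X.Opens} {m : M} (s : c.deg U m) (x : U) :
    c.fn s.1 x = AddMonoidAlgebra.single m ((c.fn s.1 x).coeff m) := by
  obtain ⟨a, ha⟩ := s.2 x
  rw [ha, AddMonoidAlgebra.coeff_single, Finsupp.single_eq_same]

/-- The homogeneous component of degree `m`. -/
def component {U : X.Opens} (m : M) (s : c.algebraSheaf.sections U) : c.deg U m :=
  ⟨c.ofFn (fun x ↦ AddMonoidAlgebra.single m ((c.fn s x).coeff m))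
    (fun x y ↦ by rw [c.fn_const s x y]) (fun x ↦ c.single_mem_stalkRing (c.fn_mem s x m)),
    fun x ↦ ⟨_, rfl⟩⟩

open scoped Classical in
theorem fn_coe {U : X.Opens} (z : DirectSum M fun m ↦ c.deg U m) (x : U) (n : M) :
    (c.fn (DirectSum.coeAddMonoidHom (c.deg U) z) x).coeff n = (c.fn (z n).1 x).coeff n := by
  induction z using DirectSum.induction_on with
  | zero => rw [map_zero]; rfl
  | of m s =>
    rw [DirectSum.coeAddMonoidHom_of]
    by_cases h : m = n
    · subst h
      rw [DirectSum.of_eq_same]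
    · rw [DirectSum.of_eq_of_ne _ _ _ (Ne.symm h), fn_deg, AddMonoidAlgebra.coeff_single,
        Finsupp.single_eq_of_ne (Ne.symm h)]
      rfl
  | add y z hy hz =>
    rw [map_add, fn_add, AddMonoidAlgebra.coeff_add, Finsupp.add_apply, hy, hz]
    rfl

open scoped Classical in
/-- The grading is a direct sum: sections over a nonempty open set are constant, hence have only
finitely many homogeneous components. -/
theorem isInternal_deg (U : X.Opens) : DirectSum.IsInternal (c.deg U) := by
  constructor
  · intro y z h
    refine DFinsupp.ext fun m ↦ Subtype.ext (c.fn_ext fun x ↦ ?_)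
    rw [fn_deg, fn_deg c (z m), ← fn_coe, ← fn_coe, h]
  · intro s
    by_cases hU : Nonempty U
    · obtain ⟨x₀⟩ := hU
      refine ⟨∑ m ∈ (c.fn s x₀).coeff.support, DirectSum.of (fun m ↦ c.deg U m) m (c.component m s),
        c.fn_ext fun x ↦ AddMonoidAlgebra.ext (Finsupp.ext fun n ↦ ?_)⟩
      rw [fn_coe, DFinsupp.finsetSum_apply]
      by_cases hn : n ∈ (c.fn s x₀).coeff.support
      · rw [Finset.sum_eq_single_of_mem n hn
          fun m _ hm ↦ DirectSum.of_eq_of_ne _ _ _ hm.symm]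
        rw [DirectSum.of_eq_same, component, fn_ofFn, AddMonoidAlgebra.coeff_single,
          Finsupp.single_eq_same]
      · rw [Finset.sum_eq_zero fun m hm ↦ DirectSum.of_eq_of_ne _ _ _
          fun h : n = m ↦ hn (h ▸ hm), c.fn_const s x x₀, Finsupp.notMem_support_iff.1 hn]
        rfl
    · exact ⟨0, c.fn_ext fun x ↦ (hU ⟨x⟩).elim⟩

/-- The underlying sheaf of graded algebras of the Cox sheaf. -/
def gradedAlgebraSheaf : GradedAlgebraSheaf X M where
  toAlgebraSheaf := c.algebraSheaf
  deg := c.deg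
  gradedMonoid U :=
    { one_mem := fun x ↦ ⟨1, rfl⟩
      mul_mem := fun m n s t hs ht x ↦ by
        obtain ⟨a, ha⟩ := hs x
        obtain ⟨b, hb⟩ := ht x
        exact ⟨a * b, by rw [fn_mul, ha, hb, AddMonoidAlgebra.single_mul_single]⟩ }
  isInternal := c.isInternal_deg
  restrict_mem h m s hs x := hs ⟨x.1, h x.2⟩

/-- The inverse of the value of the character. -/
def invVal (p : gradedDiv lam) : AlgebraicClosure X.functionField :=
  ((c.val p)⁻¹ : (AlgebraicClosure X.functionField)ˣ)

theorem invVal_mul_val (p : gradedDiv lam) : c.invVal p * c.val p = 1 := Units.inv_mul _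

theorem invVal_add {p q : gradedDiv lam} {α : kˣ}
    (hα : c.val p * c.val q = Units.map (constL f : k →* _) α * c.val (p + q)) :
    c.invVal (p + q) = algebraMap X.functionField _ (constK f α) * (c.invVal p * c.invVal q) := by
  have h1 : (c.val (p + q))⁻¹ = Units.map (constL f : k →* _) α * ((c.val p)⁻¹ * (c.val q)⁻¹) := by
    rw [← mul_inv, hα, mul_inv, mul_inv_cancel_left]
  exact congrArg Units.val h1

/-- The map `t ↦ t / c (m, D)` from `𝒪_X(D)` to the degree-`m`-part. -/
def divide (p : gradedDiv lam) (U : X.Opens) : p.1.2.sections U →ₗ[Γ(X, U)] c.deg U p.1.1 where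
  toFun t := ⟨c.ofFn (fun x ↦ AddMonoidAlgebra.single p.1.1
      (algebraMap X.functionField _ (t.1 x) * c.invVal p))
    (fun x y ↦ by rw [CaDiv.sections_const t x y]) (fun x ↦ c.single_mem_stalkRing (by
      obtain ⟨V, g, hx, hg⟩ := p.1.2.exists_localEquation x.1
      rw [c.mem_stalkDeg_iff p (hg x.1 hx), mul_assoc _ (c.invVal p),
        invVal_mul_val, mul_one, ← map_mul]
      exact algebraMap_mem_range_stalkToL.2 (t.2.2 x g (hg x.1 hx)))), fun x ↦ ⟨_, rfl⟩⟩
  map_add' s t := Subtype.ext (c.fn_ext fun x ↦ by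
    change AddMonoidAlgebra.single p.1.1 (algebraMap X.functionField _ (s.1 x + t.1 x) * _) =
      AddMonoidAlgebra.single p.1.1 _ + AddMonoidAlgebra.single p.1.1 _
    rw [map_add, add_mul, AddMonoidAlgebra.single_add])
  map_smul' r t := Subtype.ext (c.fn_ext fun x ↦ by
    change AddMonoidAlgebra.single p.1.1 (algebraMap X.functionField _ (evalAt x r * t.1 x) * _) =
      AddMonoidAlgebra.single 0 _ * AddMonoidAlgebra.single p.1.1 _
    rw [AddMonoidAlgebra.single_mul_single, zero_add, map_mul, mul_assoc]
    rfl)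

theorem fn_divide (p : gradedDiv lam) {U : X.Opens} (t : p.1.2.sections U) (x : U) :
    c.fn (c.divide p U t).1 x = AddMonoidAlgebra.single p.1.1
      (algebraMap X.functionField _ (t.1 x) * c.invVal p) :=
  rfl

theorem divide_bijective (p : gradedDiv lam) (U : X.Opens) :
    Function.Bijective (c.divide p U) := by
  constructor
  · intro s t h
    refine Subtype.ext (funext fun x ↦ ?_)
    have h1 := congrArg (fun s : c.deg U p.1.1 ↦ c.fn s.1 x) h
    have h2 := AddMonoidAlgebra.single_right_injective h1
    exact (algebraMap X.functionField (AlgebraicClosure X.functionField)).injective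
      ((Units.mul_left_inj _).1 h2)
  · intro s
    have key (x : U) : ∃ t : X.functionField, algebraMap X.functionField _ t =
        (c.fn s.1 x).coeff p.1.1 * c.val p := by
      obtain ⟨V, g, hx, hg⟩ := p.1.2.exists_localEquation x.1
      obtain ⟨b, hb⟩ := c.fn_mem s.1 x p.1.1 p rfl g (hg x.1 hx)
      refine ⟨algebraMap (X.presheaf.stalk x.1) X.functionField b * (g⁻¹ : X.functionFieldˣ), ?_⟩
      have hg1 : algebraMap X.functionField (AlgebraicClosure X.functionField) g *
          algebraMap X.functionField (AlgebraicClosure X.functionField) (g⁻¹ : X.functionFieldˣ) =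
            1 := by
        rw [← map_mul, Units.mul_inv, map_one]
      rw [map_mul]
      refine (congrArg (· * _) hb).trans ?_
      rw [mul_assoc, hg1, mul_one]
    choose t ht using key
    have hinj := (algebraMap X.functionField (AlgebraicClosure X.functionField)).injective
    refine ⟨⟨t, IsLocallyConstant.of_constant _ fun x y ↦ hinj ?_, fun x g hg ↦ ?_⟩,
      Subtype.ext (c.fn_ext fun x ↦ ?_)⟩
    · rw [ht, ht, c.fn_const s.1 x y]
    · rw [← algebraMap_mem_range_stalkToL, map_mul, ht]
      exact c.fn_mem s.1 x p.1.1 p rfl g hg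
    · rw [fn_divide, fn_deg]
      dsimp only
      rw [ht, mul_assoc, mul_comm (c.val p : AlgebraicClosure X.functionField),
        invVal_mul_val, mul_one]

/-- The isomorphism from `𝒪_X(D)` to the degree-`m`-part. -/
def divideEquiv (p : gradedDiv lam) (U : X.Opens) :
    p.1.2.sections U ≃ₗ[Γ(X, U)] c.gradedAlgebraSheaf.deg U p.1.1 :=
  LinearEquiv.ofBijective (c.divide p U) (c.divide_bijective p U)

/-- The Cox sheaf of a character. -/
def coxSheaf : CoxSheaf f lam where
  toGradedAlgebraSheaf := c.gradedAlgebraSheaf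
  coxIso p U := (c.divideEquiv p U).symm
  coxIso_restrict p {U V} h s := by
    obtain ⟨t, rfl⟩ := (c.divideEquiv p U).surjective s
    rw [LinearEquiv.symm_apply_apply, LinearEquiv.symm_apply_eq]
    exact Subtype.ext (c.fn_ext fun x ↦ rfl)
  coxIso_mul p q := by
    obtain ⟨α, hα⟩ := c.mul p q
    refine ⟨α, α.ne_zero, fun U s t ↦ ?_⟩
    obtain ⟨s, rfl⟩ := (c.divideEquiv p U).surjective s
    obtain ⟨t, rfl⟩ := (c.divideEquiv q U).surjective t
    rw [LinearEquiv.symm_apply_apply, LinearEquiv.symm_apply_apply, ← map_smul,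
      LinearEquiv.eq_symm_apply]
    refine Subtype.ext (c.fn_ext fun x ↦ ?_)
    change AddMonoidAlgebra.single (p.1.1 + q.1.1)
        (algebraMap X.functionField _ (s.1 x * t.1 x) * c.invVal (p + q)) =
      AddMonoidAlgebra.single 0 (algebraMap X.functionField _ (evalAt x (constants f U α))) *
      (AddMonoidAlgebra.single p.1.1 _ * AddMonoidAlgebra.single q.1.1 _)
    rw [AddMonoidAlgebra.single_mul_single, AddMonoidAlgebra.single_mul_single, zero_add,
      evalAt_constants, map_mul, c.invVal_add hα]
    exact congrArg _ (by ring)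

end CoxCharacter

end Existence

/-! ### Gluing isomorphisms of homogeneous parts -/

section Gluing

variable {M : Type u} [AddCommGroup M]

namespace GradedAlgebraSheaf

theorem restrict_smul (R : GradedAlgebraSheaf X M) {U V : X.Opens} (h : V ≤ U) (r : Γ(X, U))
    (s : R.sections U) : R.restrict h (r • s) = resO h r • R.restrict h s := by
  rw [Algebra.smul_def, Algebra.smul_def, map_mul]
  exact congrArg (· * _)
    (congrArg (fun φ ↦ φ.hom r) (R.structureHom.naturality (homOfLE h).op)).symm

theorem restrictDeg_smul (R : GradedAlgebraSheaf X M) {U V : X.Opens} (h : V ≤ U) {m : M}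
    (r : Γ(X, U)) (s : R.deg U m) : R.restrictDeg h (r • s) = resO h r • R.restrictDeg h s :=
  Subtype.ext (R.restrict_smul h r s.1)

/-- Induction on sections as sums of homogeneous sections. -/
theorem hom_induction (R : GradedAlgebraSheaf X M) {U : X.Opens} {P : R.sections U → Prop}
    (zero : P 0) (homogeneous : ∀ (m : M) (s : R.deg U m), P s.1)
    (add : ∀ s t, P s → P t → P (s + t)) (s : R.sections U) : P s := by
  classical
  obtain ⟨z, rfl⟩ := (R.isInternal U).2 s
  induction z using DirectSum.induction_on with
  | zero => rwa [map_zero]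
  | of m s =>
    rw [DirectSum.coeAddMonoidHom_of]
    exact homogeneous m s
  | add y z hy hz =>
    rw [map_add]
    exact add _ _ hy hz

/-- Multiplicative isomorphisms between the homogeneous parts of two sheaves of graded algebras. -/
structure DegIso (R R' : GradedAlgebraSheaf X M) where
  /-- The isomorphism in degree `m` over `U`. -/
  equiv : ∀ (m : M) (U : X.Opens), R.deg U m ≃ₗ[Γ(X, U)] R'.deg U m
  restrict : ∀ (m : M) {U V : X.Opens} (h : V ≤ U) (s : R.deg U m),
    equiv m V (R.restrictDeg h s) = R'.restrictDeg h (equiv m U s)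
  mul : ∀ (m n : M) (U : X.Opens) (s : R.deg U m) (t : R.deg U n),
    equiv (m + n) U (R.mulDeg s t) = R'.mulDeg (equiv m U s) (equiv n U t)

namespace DegIso

variable {R R' : GradedAlgebraSheaf X M}

/-- The inverse isomorphisms. -/
def symm (φ : DegIso R R') : DegIso R' R where
  equiv m U := (φ.equiv m U).symm
  restrict m U V h s := by
    rw [LinearEquiv.symm_apply_eq, φ.restrict, LinearEquiv.apply_symm_apply]
  mul m n U s t := by
    rw [LinearEquiv.symm_apply_eq, φ.mul, LinearEquiv.apply_symm_apply,
      LinearEquiv.apply_symm_apply]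

variable (φ : DegIso R R')

/-- Compatibility with equalities of degrees, which are not definitional. -/
theorem equiv_congr {m n : M} (h : m = n) {U : X.Opens} (s : R.deg U m) (t : R.deg U n)
    (hst : s.1 = t.1) : (φ.equiv m U s).1 = (φ.equiv n U t).1 := by
  subst h
  rw [Subtype.ext hst]

/-- Multiplicativity and bijectivity in degree `0` imply that `1` is preserved. -/
theorem equiv_one (U : X.Opens) : (φ.equiv 0 U ⟨1, (R.gradedMonoid U).one_mem⟩).1 = 1 := by
  obtain ⟨t, ht⟩ := (φ.equiv 0 U).surjective ⟨1, (R'.gradedMonoid U).one_mem⟩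
  have h1 := congrArg Subtype.val (φ.mul 0 0 U ⟨1, (R.gradedMonoid U).one_mem⟩ t)
  have h2 := φ.equiv_congr (add_zero 0) (R.mulDeg ⟨1, (R.gradedMonoid U).one_mem⟩ t) t (one_mul t.1)
  have h3 : (φ.equiv 0 U t).1 = 1 := congrArg Subtype.val ht
  have h4 : (R'.mulDeg (φ.equiv 0 U ⟨1, (R.gradedMonoid U).one_mem⟩) (φ.equiv 0 U t)).1 =
    (φ.equiv 0 U ⟨1, (R.gradedMonoid U).one_mem⟩).1 * (φ.equiv 0 U t).1 := rfl
  rw [h2, h4, h3, mul_one] at h1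
  exact h1.symm

theorem exists_algHom (U : X.Opens) : ∃ F : R.sections U →ₐ[Γ(X, U)] R'.sections U,
    ∀ (m : M) (s : R.deg U m), F s.1 = (φ.equiv m U s).1 := by
  classical
  let _ := R.gradedMonoid U
  let e : (DirectSum M fun m ↦ R.deg U m) ≃ₐ[Γ(X, U)] R.sections U :=
    AlgEquiv.ofBijective (DirectSum.coeAlgHom (R.deg U)) (R.isInternal U)
  let G : (DirectSum M fun m ↦ R.deg U m) →ₐ[Γ(X, U)] R'.sections U :=
    DirectSum.toAlgebra Γ(X, U) (fun m ↦ R.deg U m)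
      (fun m ↦ (R'.deg U m).subtype ∘ₗ (φ.equiv m U).toLinearMap) (φ.equiv_one U)
      fun s t ↦ congrArg Subtype.val (φ.mul _ _ U s t)
  refine ⟨G.comp e.symm.toAlgHom, fun m s ↦ ?_⟩
  have h : e.symm s.1 = DirectSum.of (fun m ↦ R.deg U m) m s := by
    rw [AlgEquiv.symm_apply_eq]
    exact (DirectSum.coeAlgHom_of (R.deg U) m s).symm
  change G (e.symm s.1) = _
  rw [h]
  exact DirectSum.toSemiring_of (A := fun m ↦ R.deg U m)
    (fun m ↦ ((R'.deg U m).subtype ∘ₗ (φ.equiv m U).toLinearMap).toAddMonoidHom) (φ.equiv_one U)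
    (fun s t ↦ congrArg Subtype.val (φ.mul _ _ U s t)) m s

/-- The homomorphism of algebras of sections over `U`. -/
def algHom (U : X.Opens) : R.sections U →ₐ[Γ(X, U)] R'.sections U := (φ.exists_algHom U).choose

theorem algHom_coe {U : X.Opens} {m : M} (s : R.deg U m) :
    φ.algHom U s.1 = (φ.equiv m U s).1 := (φ.exists_algHom U).choose_spec m s

theorem algHom_restrict {U V : X.Opens} (h : V ≤ U) (s : R.sections U) :
    φ.algHom V (R.restrict h s) = R'.restrict h (φ.algHom U s) := by
  induction s using R.hom_induction with
  | zero => simp only [map_zero]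
  | homogeneous m s =>
    rw [algHom_coe]
    exact (φ.algHom_coe (R.restrictDeg h s)).trans (congrArg Subtype.val (φ.restrict m h s))
  | add s t hs ht => simp only [map_add, hs, ht]

theorem algHom_symm {U : X.Opens} (s : R.sections U) :
    φ.symm.algHom U (φ.algHom U s) = s := by
  induction s using R.hom_induction with
  | zero => simp only [map_zero]
  | homogeneous m s =>
    rw [algHom_coe, algHom_coe]
    exact congrArg Subtype.val ((φ.equiv m U).symm_apply_apply s)
  | add s t hs ht => simp only [map_add, hs, ht]

/-- The morphism of sheaves of graded algebras. -/
def hom : R ⟶ R' where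
  hom :=
    { app U := CommRingCat.ofHom (φ.algHom U.unop).toRingHom
      naturality _ _ i := CommRingCat.hom_ext (RingHom.ext fun s ↦ φ.algHom_restrict i.unop.le s) }
  structureHom_comp := NatTrans.ext (funext fun U ↦ CommRingCat.hom_ext (RingHom.ext fun r ↦
    (φ.algHom U.unop).commutes r))
  map_mem U m s hs := by
    have h : φ.algHom U s = (φ.equiv m U ⟨s, hs⟩).1 := φ.algHom_coe (⟨s, hs⟩ : R.deg U m)
    exact (congrArg (· ∈ R'.deg U m) h).mpr (φ.equiv m U ⟨s, hs⟩).2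

theorem hom_comp_symm : φ.hom ≫ φ.symm.hom = 𝟙 R :=
  GradedAlgebraSheaf.Hom.ext (NatTrans.ext (funext fun U ↦ CommRingCat.hom_ext
    (RingHom.ext fun s ↦ φ.algHom_symm (U := U.unop) s)))

end DegIso

end GradedAlgebraSheaf

end Gluing

/-! ### Uniqueness of Cox sheaves -/

section Uniqueness

theorem resO_constants {k : Type u} [Field k] (f : X ⟶ Spec (CommRingCat.of k)) {U V : X.Opens}
    (h : V ≤ U) (a : k) : resO h (constants f U a) = constants f V a :=
  resO_resO _ _ _

variable {k : Type u} [Field k] [IsIntegral X] {M : Type u} [AddCommGroup M]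
  {f : X ⟶ Spec (CommRingCat.of k)} {lam : M →+ Additive (Pic X)}

namespace CoxSheaf

variable (R R' : CoxSheaf f lam)

theorem coxIso_smul_apply (p : gradedDiv lam) {U : X.Opens} (a : k) (s : R.deg U p.1.1) (x : U) :
    (R.coxIso p U (constants f U a • s)).1 x = constK f a * (R.coxIso p U s).1 x := by
  rw [map_smul, CaDiv.smul_apply, evalAt_constants]

theorem exists_coxIso_mul (p q : gradedDiv lam) : ∃ α : kˣ,
    ∀ (U : X.Opens) (s : R.deg U p.1.1) (t : R.deg U q.1.1) (x : U),
      (R.coxIso p U s).1 x * (R.coxIso q U t).1 x =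
        constK f α * (R.coxIso (p + q) U (R.mulDeg s t)).1 x := by
  obtain ⟨α, hα, h⟩ := R.coxIso_mul p q
  refine ⟨Units.mk0 α hα, fun U s t x ↦ ?_⟩
  refine (congrFun (congrArg Subtype.val (h U s t)) x).trans ?_
  rw [CaDiv.smul_apply, evalAt_constants]
  rfl

/-- The isomorphisms for two divisors in the same degree differ by a rational function. -/
theorem exists_coxIso_eq {m : M} {D D' : CaDiv X} (h : ((m, D) : M × CaDiv X) ∈ gradedDiv lam)
    (h' : ((m, D') : M × CaDiv X) ∈ gradedDiv lam) :
    ∃ g : X.functionFieldˣ, (∀ (U : X.Opens) (s : R.deg U m) (x : U),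
      (R.coxIso ⟨(m, D'), h'⟩ U s).1 x = g * (R.coxIso ⟨(m, D), h⟩ U s).1 x) ∧
      D = D' + CaDiv.principal g := by
  obtain ⟨g, hg, hD⟩ := CaDiv.exists_mul_of_equiv (D := D) (D' := D')
    (fun U ↦ (R.coxIso ⟨(m, D), h⟩ U).symm.trans (R.coxIso ⟨(m, D'), h'⟩ U)) fun {U V} hV s ↦ by
      obtain ⟨s, rfl⟩ := (R.coxIso ⟨(m, D), h⟩ U).surjective s
      have h1 := R.coxIso_restrict ⟨(m, D), h⟩ hV s
      rw [LinearEquiv.trans_apply, LinearEquiv.trans_apply]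
      refine Eq.trans ?_ ((R.coxIso_restrict ⟨(m, D'), h'⟩ hV s).trans ?_)
      · rw [← h1, LinearEquiv.symm_apply_apply]
      · rw [LinearEquiv.symm_apply_apply]
  refine ⟨g, fun U s x ↦ ?_, hD⟩
  have h1 := hg U (R.coxIso ⟨(m, D), h⟩ U s) x
  rw [LinearEquiv.trans_apply, LinearEquiv.symm_apply_apply] at h1
  exact h1

theorem coxIso_apply_ne_zero (p : gradedDiv lam) {U : X.Opens} {s : R.deg U p.1.1}
    (hs : s ≠ 0) (x : U) : (R.coxIso p U s).1 x ≠ 0 := fun h ↦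
  hs ((R.coxIso p U).injective (Subtype.ext (funext fun y ↦ by
    rw [CaDiv.sections_const _ y x, h, map_zero]; rfl)))

theorem nonempty_of_ne_zero {m : M} {U : X.Opens} {s : R.deg U m} (hs : s ≠ 0) : Nonempty U := by
  by_contra h
  obtain ⟨D, hD⟩ := exists_gradedDiv lam m
  exact hs ((R.coxIso ⟨(m, D), hD⟩ U).injective (Subtype.ext (funext fun x ↦ (h ⟨x⟩).elim)))

theorem mulDeg_ne_zero {m n : M} {U : X.Opens} {s : R.deg U m} {t : R.deg U n}
    (hs : s ≠ 0) (ht : t ≠ 0) : R.mulDeg s t ≠ 0 := by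
  intro h0
  obtain ⟨D, hD⟩ := exists_gradedDiv lam m
  obtain ⟨D', hD'⟩ := exists_gradedDiv lam n
  obtain ⟨x⟩ := R.nonempty_of_ne_zero hs
  obtain ⟨α, hα⟩ := R.exists_coxIso_mul ⟨(m, D), hD⟩ ⟨(n, D'), hD'⟩
  have h1 := hα U s t x
  have h2 : R.coxIso (⟨(m, D), hD⟩ + ⟨(n, D'), hD'⟩) U (R.mulDeg s t) = 0 :=
    (congrArg _ h0).trans (map_zero _)
  rw [h2] at h1
  exact mul_ne_zero (R.coxIso_apply_ne_zero _ hs x) (R.coxIso_apply_ne_zero _ ht x)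
    (h1.trans (mul_zero _))

theorem constants_smul_cancel {m : M} {U : X.Opens} {s : R.deg U m} (hs : s ≠ 0) {a b : k}
    (h : constants f U a • s = constants f U b • s) : a = b := by
  obtain ⟨D, hD⟩ := exists_gradedDiv lam m
  obtain ⟨x⟩ := R.nonempty_of_ne_zero hs
  let p : gradedDiv lam := ⟨(m, D), hD⟩
  have h1 := (R.coxIso_smul_apply p a s x).symm.trans
    ((congrArg (fun s ↦ (R.coxIso p U s).1 x) h).trans (R.coxIso_smul_apply p b s x))
  exact (constK f).injective (mul_right_cancel₀ (R.coxIso_apply_ne_zero p hs x) h1)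

/-- Over small neighbourhoods of the generic point, the homogeneous parts are nonzero. -/
theorem exists_ne_zero (m : M) : ∃ U : X.Opens, genericPoint X ∈ U ∧ ∀ V ≤ U,
    genericPoint X ∈ V → ∃ s : R.deg V m, s ≠ 0 := by
  obtain ⟨D, hD⟩ := exists_gradedDiv lam m
  obtain ⟨U, g, hU, hg⟩ := D.exists_localEquation (genericPoint X)
  refine ⟨U, hU, fun V hV hη ↦
    ⟨(R.coxIso ⟨(m, D), hD⟩ V).symm (CaDiv.gen fun y hy ↦ hg y (hV hy)), fun h ↦ ?_⟩⟩
  rw [LinearEquiv.symm_apply_eq, map_zero] at h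
  exact Units.ne_zero g⁻¹ (congrFun (congrArg Subtype.val h) ⟨genericPoint X, hη⟩)

variable {R R'} in
/-- Two Cox sheaves have isomorphic homogeneous parts, and the isomorphisms are compatible with the
multiplication up to constants. -/
theorem exists_equiv (hX : ∀ a : Γ(X, ⊤)ˣ, ∃ c : k, constants f ⊤ c = a) :
    ∃ φ : ∀ (m : M) (U : X.Opens), R.deg U m ≃ₗ[Γ(X, U)] R'.deg U m,
      (∀ (m : M) {U V : X.Opens} (h : V ≤ U) (s : R.deg U m),
        φ m V (R.restrictDeg h s) = R'.restrictDeg h (φ m U s)) ∧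
      ∃ a : M → M → kˣ, ∀ (m n : M) (U : X.Opens) (s : R.deg U m) (t : R.deg U n),
        R'.mulDeg (φ m U s) (φ n U t) = constants f U (a m n) • φ (m + n) U (R.mulDeg s t) := by
  choose D hD using exists_gradedDiv lam
  let φ (m : M) (U : X.Opens) : R.deg U m ≃ₗ[Γ(X, U)] R'.deg U m :=
    (R.coxIso ⟨(m, D m), hD m⟩ U).trans (R'.coxIso ⟨(m, D m), hD m⟩ U).symm
  have hφ (m : M) (U : X.Opens) (s : R.deg U m) :
      R'.coxIso ⟨(m, D m), hD m⟩ U (φ m U s) = R.coxIso ⟨(m, D m), hD m⟩ U s :=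
    (R'.coxIso ⟨(m, D m), hD m⟩ U).apply_symm_apply _
  refine ⟨φ, fun m U V h s ↦ (R'.coxIso ⟨(m, D m), hD m⟩ V).injective ?_, ?_⟩
  · rw [hφ]
    refine (R.coxIso_restrict ⟨(m, D m), hD m⟩ h s).trans ?_
    refine Eq.trans ?_ (R'.coxIso_restrict ⟨(m, D m), hD m⟩ h (φ m U s)).symm
    rw [hφ]
  · have key (m n : M) : ∃ a : kˣ, ∀ (U : X.Opens) (s : R.deg U m) (t : R.deg U n),
        R'.mulDeg (φ m U s) (φ n U t) = constants f U a • φ (m + n) U (R.mulDeg s t) := by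
      let p : gradedDiv lam := ⟨(m, D m), hD m⟩
      let q : gradedDiv lam := ⟨(n, D n), hD n⟩
      let r : gradedDiv lam := ⟨(m + n, D (m + n)), hD (m + n)⟩
      obtain ⟨α, hα⟩ := R.exists_coxIso_mul p q
      obtain ⟨β, hβ⟩ := R'.exists_coxIso_mul p q
      -- `p + q` and `r` have the same degree but different divisors; the resulting factors for `R`
      -- and `R'` have the same divisor, so they agree up to a constant.
      obtain ⟨g, hg, hgD⟩ := R.exists_coxIso_eq (hD (m + n)) (p + q).2
      obtain ⟨g', hg', hgD'⟩ := R'.exists_coxIso_eq (hD (m + n)) (p + q).2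
      obtain ⟨γ, hγ⟩ := exists_const_of_principal_eq hX (add_left_cancel (hgD.symm.trans hgD'))
      refine ⟨β⁻¹ * α * γ, fun U s t ↦ (R'.coxIso r U).injective
        (Subtype.ext (funext fun x ↦ ?_))⟩
      have h1 := hα U s t x
      have h2 := hβ U (φ m U s) (φ n U t) x
      have h3 : (R.coxIso (p + q) U (R.mulDeg s t)).1 x = g * (R.coxIso r U (R.mulDeg s t)).1 x :=
        hg U (R.mulDeg s t) x
      have h4 : (R'.coxIso (p + q) U (R'.mulDeg (φ m U s) (φ n U t))).1 x =
        g' * (R'.coxIso r U (R'.mulDeg (φ m U s) (φ n U t))).1 x := hg' U _ x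
      have h5 := congrArg Units.val hγ
      have h6 : (g : X.functionField) = constK f γ * g' := h5
      have h7 : constK f ((β⁻¹ : kˣ) : k) * constK f β = 1 := by
        rw [← map_mul, Units.inv_mul, map_one]
      have h8 : R'.coxIso r U (φ (m + n) U (R.mulDeg s t)) = R.coxIso r U (R.mulDeg s t) :=
        hφ (m + n) U (R.mulDeg s t)
      refine Eq.trans ?_ (R'.coxIso_smul_apply r _ (φ (m + n) U (R.mulDeg s t)) x).symm
      rw [h8, Units.val_mul, Units.val_mul, map_mul, map_mul]
      rw [hφ m, hφ n] at h2
      refine mul_left_cancel₀ (Units.ne_zero g') ?_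
      rw [h3, h6] at h1
      rw [← h4]
      have h9 := h2.symm.trans h1
      linear_combination constK f ((β⁻¹ : kˣ) : k) * h9 -
        (R'.coxIso (p + q) U (R'.mulDeg (φ m U s) (φ n U t))).1 x * h7
    choose a ha using key
    exact ⟨a, ha⟩

end CoxSheaf

end Uniqueness

section Rescaling

variable {k : Type u} [Field k] [IsIntegral X] {M : Type u} [AddCommGroup M]
  {f : X ⟶ Spec (CommRingCat.of k)} {lam : M →+ Additive (Pic X)}

/-- Over a separably closed field whose characteristic does not divide the order of the torsion,
roots of the orders of torsion elements exist. -/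
theorem exists_nsmul_eq_of_isSepClosed [IsSepClosed k]
    (hM : ¬ ringChar k ∣ Nat.card (AddCommGroup.torsion M)) (g : M) (n : ℕ) (hn : n ≠ 0)
    (hg : addOrderOf g = n) (c : Additive kˣ) : ∃ d, n • d = c := by
  have hmem : g ∈ AddCommGroup.torsion M := by
    refine addOrderOf_pos_iff.1 ?_
    rw [hg]
    exact Nat.pos_of_ne_zero hn
  have hdvd : n ∣ Nat.card (AddCommGroup.torsion M) := by
    rw [← hg]
    exact (AddSubgroup.addOrderOf_mk g hmem) ▸
      addOrderOf_dvd_natCard (⟨g, hmem⟩ : AddCommGroup.torsion M)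
  have : NeZero (n : k) := ⟨fun h ↦ hM (((ringChar.spec k n).1 h).trans hdvd)⟩
  obtain ⟨z, hz⟩ := IsSepClosed.exists_pow_nat_eq (c.toMul : k) n
  have hz0 : z ≠ 0 := by
    rintro rfl
    exact c.toMul.ne_zero (by rw [← hz, zero_pow hn])
  exact ⟨Additive.ofMul (Units.mk0 z hz0), Additive.toMul.injective (Units.ext hz)⟩

namespace CoxSheaf

/-- The isomorphisms of homogeneous parts of two Cox sheaves can be rescaled to be multiplicative:
they are so up to a symmetric `2`-cocycle on `M` with values in `kˣ`, which is a coboundary. -/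
theorem nonempty_degIso [IsSepClosed k] [AddGroup.FG M]
    (hX : ∀ a : Γ(X, ⊤)ˣ, ∃ c : k, constants f ⊤ c = a)
    (hM : ¬ ringChar k ∣ Nat.card (AddCommGroup.torsion M)) (R R' : CoxSheaf f lam) :
    Nonempty (GradedAlgebraSheaf.DegIso R.toGradedAlgebraSheaf R'.toGradedAlgebraSheaf) := by
  obtain ⟨φ, hφ, a, ha⟩ := exists_equiv (R := R) (R' := R') hX
  have hne {m : M} {U : X.Opens} {s : R.deg U m} (hs : s ≠ 0) : φ m U s ≠ 0 :=
    fun h ↦ hs ((φ m U).map_eq_zero_iff.1 h)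
  have hcongr {m n : M} (h : m = n) {U : X.Opens} (s : R.deg U m) (t : R.deg U n)
      (hst : s.1 = t.1) : (φ m U s).1 = (φ n U t).1 := by
    subst h
    rw [Subtype.ext hst]
  have ha' (m n : M) (U : X.Opens) (s : R.deg U m) (t : R.deg U n) :
      (φ m U s).1 * (φ n U t).1 = constants f U (a m n) • (φ (m + n) U (R.mulDeg s t)).1 :=
    congrArg Subtype.val (ha m n U s t)
  -- The cocycle identities are tested on products of nonzero sections near the generic point.
  have hcomm (m n : M) : a m n = a n m := by
    obtain ⟨U, hU, hs⟩ := R.exists_ne_zero m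
    obtain ⟨V, hV, ht⟩ := R.exists_ne_zero n
    obtain ⟨s, hs⟩ := hs (U ⊓ V) inf_le_left ⟨hU, hV⟩
    obtain ⟨t, ht⟩ := ht (U ⊓ V) inf_le_right ⟨hU, hV⟩
    refine Units.ext (R'.constants_smul_cancel (hne (R.mulDeg_ne_zero hs ht)) (Subtype.ext ?_))
    refine (ha' m n _ s t).symm.trans ((mul_comm _ _).trans ((ha' n m _ t s).trans ?_))
    exact congrArg _ (hcongr (add_comm n m) _ _ (mul_comm _ _))
  have hassoc (m n l : M) : a m n * a (m + n) l = a n l * a m (n + l) := by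
    obtain ⟨U, hU, hs⟩ := R.exists_ne_zero m
    obtain ⟨V, hV, ht⟩ := R.exists_ne_zero n
    obtain ⟨W, hW, hr⟩ := R.exists_ne_zero l
    obtain ⟨s, hs⟩ := hs (U ⊓ V ⊓ W) (inf_le_left.trans inf_le_left) ⟨⟨hU, hV⟩, hW⟩
    obtain ⟨t, ht⟩ := ht (U ⊓ V ⊓ W) (inf_le_left.trans inf_le_right) ⟨⟨hU, hV⟩, hW⟩
    obtain ⟨r, hr⟩ := hr (U ⊓ V ⊓ W) inf_le_right ⟨⟨hU, hV⟩, hW⟩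
    refine Units.ext (R'.constants_smul_cancel
      (hne (R.mulDeg_ne_zero (R.mulDeg_ne_zero hs ht) hr)) (Subtype.ext ?_))
    have h1 := ha' (m + n) l _ (R.mulDeg s t) r
    have h2 := ha' m (n + l) _ s (R.mulDeg t r)
    rw [← hcongr (add_assoc m n l) (R.mulDeg (R.mulDeg s t) r) _ (mul_assoc _ _ _)] at h2
    refine Eq.trans (b := (φ m _ s).1 * (φ n _ t).1 * (φ l _ r).1) ?_ ?_
    · rw [ha', smul_mul_assoc, h1, smul_smul, ← map_mul]
      rfl
    · rw [mul_assoc, ha', mul_smul_comm, h2, smul_smul, ← map_mul]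
      rfl
  obtain ⟨β, hβ⟩ := exists_coboundary (exists_nsmul_eq_of_isSepClosed hM)
    (fun m n ↦ Additive.ofMul (a m n)) (fun m n ↦ congrArg _ (hcomm m n))
    fun m n l ↦ congrArg Additive.ofMul (hassoc m n l)
  have hβ' (m n : M) : ((β m).toMul * (β n).toMul * a m n : k) = (β (m + n)).toMul :=
    congrArg (fun b : Additive kˣ ↦ (b.toMul : k)) (hβ m n)
  refine ⟨⟨fun m U ↦ (φ m U).trans (LinearEquiv.smulOfUnit
    (Units.map (constants f U : k →* Γ(X, U)) (β m).toMul)),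
    fun m U V h s ↦ ?_, fun m n U s t ↦ ?_⟩⟩
  · change constants f V _ • φ m V _ = R'.restrictDeg h (constants f U _ • φ m U s)
    rw [R'.restrictDeg_smul, resO_constants, hφ]
  · refine Subtype.ext ?_
    change constants f U _ • (φ (m + n) U _).1 =
      (constants f U (β m).toMul • (φ m U s).1) * (constants f U (β n).toMul • (φ n U t).1)
    rw [smul_mul_smul_comm, ha', smul_smul, ← map_mul, ← map_mul, hβ']

end CoxSheaf

end Rescaling
end CoxSheaves

end

theorem mainTheorem3 {k : Type u} [Field k] [IsSepClosed k]
    {X : Scheme.{u}} [AlgebraicGeometry.IsIntegral X] (f : X ⟶ Spec (CommRingCat.of k))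
    [IsSeparated f] [LocallyOfFiniteType f] [QuasiCompact f]
    (hX : ∀ a : Γ(X, ⊤)ˣ, ∃ c : k, CoxSheaves.constants f ⊤ c = a)
    {M : Type u} [AddCommGroup M] [AddGroup.FG M]
    (hM : ¬ ringChar k ∣ Nat.card (AddCommGroup.torsion M))
    (lam : M →+ Additive (CoxSheaves.Pic X)) :
    Nonempty (CoxSheaves.CoxSheaf f lam) ∧
      ∀ R R' : CoxSheaves.CoxSheaf f lam, Nonempty (R ≅ R') := by
  refine ⟨?_, fun R R' ↦ ?_⟩
  · obtain ⟨c⟩ := CoxSheaves.nonempty_coxCharacter f hX lam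
    exact ⟨c.coxSheaf⟩
  · obtain ⟨φ⟩ := CoxSheaves.CoxSheaf.nonempty_degIso hX hM R R'
    exact ⟨{ hom := φ.hom, inv := φ.symm.hom,
             hom_inv_id := φ.hom_comp_symm, inv_hom_id := φ.symm.hom_comp_symm }⟩
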